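/- For every $n\ge 3$, the time-bounded reachability game problem for (unrestricted) recursive stopwatch automata with $n$ stopwatches is undecidable. The notions are as follows. *Syntax.* Let $X$ be a set of $n$ variables; a rectangular constraint over $X$ is a finite conjunction of constraints $x\bowtie k$ with $x\in X$, $k\in\mathbb Z$, $\bowtie\in\{<,\le,=,\ge,>\}$. A recursive stopwatch automaton $\mathcal H$ over $X$ is a finite list of components $\mathcal H_1,\dots,\mathcal H_k$. Each component $\mathcal H_i$ has a finite set $N_i$ of nodes with disjoint subsets $\mathrm{En}_i$ (entry nodes) and $\mathrm{Ex}_i$ (exit nodes); a finite set $B_i$ of boxes, each box $b$ with a component $Y(b)\in\{1,\dots,k\}$ and an arbitrary set $P(b)\subseteq X$ of variables passed by value (the others are passed by reference; "unrestricted" means that no condition is put on $P(b)$); a finite set $A_i$ of actions, each action $a$ with a reset set $J(a)\subseteq X$; a partial transition function $Q_i\times A_i\rightharpoonup Q_i$ on its set of locations $Q_i=N_i\cup\{(b,en): b\in B_i, en\in \mathrm{En}_{Y(b)}\}\cup\{(b,ex): b\in B_i, ex\in \mathrm{Ex}_{Y(b)}\}$ (nodes, call ports, return ports), without transitions from call ports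 and exit nodes; for each location $q$ a rectangular invariant $\mathrm{Inv}(q)$ and a rate vector $F(q)\in\{0,1\}^X$; and for each pair $(q,a)$ a rectangular guard $E(q,a)$. All these sets are disjoint for different components; $Q$ and $A$ denote the unions of the $Q_i$ and the $A_i$. *Semantics.* States are triples $(\kappa,q,\nu)$ with a finite stack $\kappa$ of pairs (box, valuation), a location $q$, and a valuation $\nu\in\mathbb R^X$ with $\nu\in \mathrm{Inv}(q)$. A timed action is a pair $(t,a)$ of a delay $t\in\mathbb R_{\ge0}$ and an action $a\in A$. It leads from $(\kappa,q,\nu)$ to the state (1) $(\kappa\cdot(b,\nu),en,\nu)$, if $q=(b,en)$ is a call port and $t=0$; (2) $(\kappa',(b,ex),\nu')$, if $q=ex$ is an exit node, $\kappa=\kappa'\cdot(b,\nu'')$ with $ex\in\mathrm{Ex}_{Y(b)}$, and $t=0$, where $\nu'$ equals $\nu''$ on $P(b)$ and $\nu$ elsewhere; (3) $(\kappa,q',\nu')$, if $q$ is any other location, $q'$ is the successor of $q$ under $a$, $\nu+F(q)t'\in \mathrm{Inv}(q)$ for all $t'\in[0,t]$, and $\nu+F(q)t\in E(q,a)$, where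 $\nu'$ is obtained from $\nu+F(q)t$ by setting the variables in $J(a)$ to $0$. The timed action is available only if the result is a state, that is, satisfies the invariant of its location. *Game.* The locations are partitioned between two players, Achilles and Tortoise. The player who controls the location of the current state chooses the next timed action among the available ones, by a strategy that may depend on the whole run so far; a run ends when no timed action is available. *Problem.* Given a recursive stopwatch automaton with $n$ stopwatches, a partition of its locations, an initial node $q$, a rational initial valuation $\nu\in\mathrm{Inv}(q)$, a set $F\subseteq Q$ of final locations and a bound $T\in\mathbb N$, decide whether Achilles has a strategy such that, for every strategy of Tortoise, the resulting run from $(\varepsilon,q,\nu)$ has a finite prefix that ends in a state with location in $F$ and whose delays sum to at most $T$. For no $n\ge3$ is there an algorithm that solves this problem. -/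

import Mathlib

open scoped NNReal

/-! ### Reachability games on labelled transition systems -/

/-- A labelled transition system with a (partial) transition function: `trans s a = none` means
that the action `a` is not available in the state `s`. -/
structure LTS (S A : Type) where
  trans : S → A → Option S

namespace LTS

variable {S A : Type}

/-- A finite alternating sequence `s₀, a₁, s₁, …, aₘ, sₘ`. `last` is the state `sₘ`, and `past`
lists the pairs `(sᵢ, aᵢ₊₁)` for `i < m`, most recent first. -/
structure Run (S A : Type) where
  past : List (S × A)
  last : S

/-- The action `a` is available in the state `s`, that is `a ∈ A(s)`. -/
def Avail (L : LTS S A) (s : S) (a : A) : Prop := ∃ s', L.trans s a = some s'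

/-- A (history dependent, deterministic) strategy of the player who controls the states in `P`:
after every finite run that ends in a state of `P` with at least one available action it chooses
an available action. What it does on other sequences is immaterial. -/
structure Strategy (L : LTS S A) (P : Set S) where
  act : Run S A → Option A
  valid : ∀ r : Run S A, r.last ∈ P → (∃ a, L.Avail r.last a) →
    ∃ a, act r = some a ∧ L.Avail r.last a

/-- The action that the two strategies choose after the finite run `r`: the player
who controls the last state decides. -/
noncomputable def choice (L : LTS S A) {P : Set S} (σ : L.Strategy P) (τ : L.Strategy Pᶜ)
    (r : Run S A) : Option A :=
  open Classical in if r.last ∈ P then σ.act r else τ.act r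

/-- The prefix with `k` transitions of the unique run from `s` when the players use the strategies
`σ` and `τ`; when a state without available actions is reached, the run stops there. -/
noncomputable def play (L : LTS S A) {P : Set S} (σ : L.Strategy P) (τ : L.Strategy Pᶜ)
    (s : S) : ℕ → Run S A
  | 0 => ⟨[], s⟩
  | k + 1 =>
    let r := L.play σ τ s k
    match L.choice σ τ r with
    | none => r
    | some a =>
      match L.trans r.last a with
      | none => r
      | some s' => ⟨(r.last, a) :: r.past, s'⟩

end LTS

/-! ### Syntax of recursive hybrid automata

Everything is finite data, so that automata can be inputs of algorithms. The variables are the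
elements of `Fin n`. -/

namespace RHA

inductive Rel
  | lt | le | eq | ge | gt
  deriving DecidableEq

/-- The atomic constraint `x ⋈ k`. -/
structure Atom (n : ℕ) where
  var : Fin n
  rel : Rel
  const : ℤ

/-- A rectangular constraint: a finite conjunction of atomic constraints (`⊤` is the empty one). -/
abbrev Rect (n : ℕ) := List (Atom n)

/-- Locations of a component: nodes, call ports `(b, en)` and return ports `(b, ex)`. -/
inductive Loc
  | node (v : ℕ)
  | call (b en : ℕ)
  | ret (b ex : ℕ)
  deriving DecidableEq

/-- A component. Its nodes are `0, …, numNodes - 1`, its boxes `0, …, boxes.length - 1` and its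
actions `0, …, resets.length - 1`. Functions on the (finite) sets of locations and actions are
given by finite tables, see `tr`, `guard`, `inv` and `flow` below. -/
structure Component (n : ℕ) where
  numNodes : ℕ
  entries : List ℕ
  exits : List ℕ
  /-- for each box `b` the component `Y(b)` it is mapped to and the set `P(b)` of
  the variables that are passed by value -/
  boxes : List (ℕ × List (Fin n))
  /-- for each action `a` the set `J(a)` of the variables that are reset -/
  resets : List (List (Fin n))
  transTable : List ((Loc × ℕ) × Loc)
  guardTable : List ((Loc × ℕ) × Rect n)
  invTable : List (Loc × Rect n)
  flowTable : List (Loc × (Fin n → ℕ))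

namespace Component

variable {n : ℕ}

def empty (n : ℕ) : Component n := ⟨0, [], [], [], [], [], [], [], []⟩

/-- `Y(b)` -/
def target (C : Component n) (b : ℕ) : ℕ := (C.boxes.getD b (0, [])).1

/-- `P(b)` -/
def byValue (C : Component n) (b : ℕ) : List (Fin n) := (C.boxes.getD b (0, [])).2

/-- `J(a)` -/
def reset (C : Component n) (a : ℕ) : List (Fin n) := C.resets.getD a []

/-- The transition function; pairs that are not listed have no transition. -/
def tr (C : Component n) (q : Loc) (a : ℕ) : Option Loc := C.transTable.lookup (q, a)

/-- The action enabledness function `E(q, a)`; pairs that are not listed have the value `⊤`. -/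
def guard (C : Component n) (q : Loc) (a : ℕ) : Rect n := (C.guardTable.lookup (q, a)).getD []

/-- The invariant of a location; locations that are not listed have the invariant `⊤`. -/
def inv (C : Component n) (q : Loc) : Rect n := (C.invTable.lookup q).getD []

/-- The rate of each variable in a location; in locations that are not listed, all rates are 1. -/
def flow (C : Component n) (q : Loc) : Fin n → ℕ := (C.flowTable.lookup q).getD (fun _ => 1)

end Component

/-- A recursive hybrid automaton over the variables `Fin n`, as the list of its components. Boxes,
locations and actions of different components are kept apart by the index of the component:
a global box is a pair (component, box), and likewise for locations and actions. -/
structure Automaton (n : ℕ) where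
  comps : List (Component n)

namespace Automaton

variable {n : ℕ}

def comp (H : Automaton n) (i : ℕ) : Component n := H.comps.getD i (Component.empty n)

/-- `(i, q)` is a location of the automaton: `q ∈ Q_i`. -/
def IsLoc (H : Automaton n) (i : ℕ) : Loc → Prop
  | .node v => i < H.comps.length ∧ v < (H.comp i).numNodes
  | .call b en => i < H.comps.length ∧ b < (H.comp i).boxes.length ∧
      en ∈ (H.comp ((H.comp i).target b)).entries
  | .ret b ex => i < H.comps.length ∧ b < (H.comp i).boxes.length ∧
      ex ∈ (H.comp ((H.comp i).target b)).exits

/-- `(i, a)` is an action of the automaton: `a ∈ A_i`. -/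
def IsAction (H : Automaton n) (a : ℕ × ℕ) : Prop :=
  a.1 < H.comps.length ∧ a.2 < (H.comp a.1).resets.length

/-- Locations of component `i` that may have outgoing transitions: all but call ports and
exit nodes. -/
def IsInternal (H : Automaton n) (i : ℕ) : Loc → Prop
  | .node v => v ∉ (H.comp i).exits
  | .call _ _ => False
  | .ret _ _ => True

/-- The data form a recursive hybrid automaton. -/
structure WellFormed (H : Automaton n) : Prop where
  entries : ∀ i < H.comps.length, ∀ v ∈ (H.comp i).entries, v < (H.comp i).numNodes
  exits : ∀ i < H.comps.length, ∀ v ∈ (H.comp i).exits, v < (H.comp i).numNodes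
  disjoint : ∀ i < H.comps.length, ∀ v ∈ (H.comp i).entries, v ∉ (H.comp i).exits
  boxes : ∀ i < H.comps.length, ∀ b < (H.comp i).boxes.length,
    (H.comp i).target b < H.comps.length
  trans : ∀ i < H.comps.length, ∀ q a q', ((q, a), q') ∈ (H.comp i).transTable →
    H.IsLoc i q ∧ H.IsInternal i q ∧ a < (H.comp i).resets.length ∧ H.IsLoc i q'

/-- A recursive stopwatch automaton: in every location every variable has rate 0 or 1. -/
def IsStopwatch (H : Automaton n) : Prop :=
  ∀ i q, H.IsLoc i q → ∀ x, (H.comp i).flow q x = 0 ∨ (H.comp i).flow q x = 1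

end Automaton

/-! ### Semantics of recursive hybrid automata -/

variable {n : ℕ}

def Rel.Holds : Rel → ℝ → ℝ → Prop
  | .lt, u, v => u < v
  | .le, u, v => u ≤ v
  | .eq, u, v => u = v
  | .ge, u, v => u ≥ v
  | .gt, u, v => u > v

/-- The set of valuations that satisfy a rectangular constraint. -/
def sat (G : Rect n) : Set (Fin n → ℝ) := {ν | ∀ c ∈ G, c.rel.Holds (ν c.var) c.const}

/-- A configuration `(⟨κ⟩, q, ν)`; the location `q` is given by its component and its place there.
The head of the list `ctx` is the top of the stack of pending calls. -/
structure Config (n : ℕ) where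
  ctx : List ((ℕ × ℕ) × (Fin n → ℝ))
  comp : ℕ
  loc : Loc
  val : Fin n → ℝ

/-- Timed actions: a delay and an action. -/
abbrev TimedAction := ℝ≥0 × (ℕ × ℕ)

namespace Automaton

/-- The valuation of the configuration satisfies the invariant of its location. -/
def InInv (H : Automaton n) (s : Config n) : Prop := s.val ∈ sat ((H.comp s.comp).inv s.loc)

/-- `ν + F(q) · t` -/
def elapse (H : Automaton n) (s : Config n) (t : ℝ≥0) : Fin n → ℝ :=
  fun x => s.val x + ((H.comp s.comp).flow s.loc x : ℝ) * (t : ℝ)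

/-- From a call port: push the box with the current valuation, go to the entry node. -/
noncomputable def callStep (H : Automaton n) (s : Config n) (e : TimedAction) (b en : ℕ) :
    Option (Config n) :=
  open Classical in
  if e.1 = 0 ∧ H.IsAction e.2 then
    some ⟨((s.comp, b), s.val) :: s.ctx, (H.comp s.comp).target b, .node en, s.val⟩
  else none

/-- From an exit node: pop the top of the stack, go to the return port, and restore
the variables that were passed by value. There is no such step when the stack is empty. -/
noncomputable def returnStep (H : Automaton n) (s : Config n) (e : TimedAction) (ex : ℕ) :
    Option (Config n) :=
  open Classical in
  match s.ctx with
  | [] => none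
  | ((i, b), ν) :: κ =>
    if e.1 = 0 ∧ H.IsAction e.2 ∧ (H.comp i).target b = s.comp then
      some ⟨κ, i, .ret b ex, fun x => if x ∈ (H.comp i).byValue b then ν x else s.val x⟩
    else none

/-- From any other location: let time pass within the invariant, then take an enabled transition
and reset variables. -/
noncomputable def internalStep (H : Automaton n) (s : Config n) (e : TimedAction) :
    Option (Config n) :=
  open Classical in
  match (H.comp s.comp).tr s.loc e.2.2 with
  | none => none
  | some q' =>
    if e.2.1 = s.comp ∧
        (∀ t' : ℝ≥0, t' ≤ e.1 → H.elapse s t' ∈ sat ((H.comp s.comp).inv s.loc)) ∧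
        H.elapse s e.1 ∈ sat ((H.comp s.comp).guard s.loc e.2.2) then
      some ⟨s.ctx, s.comp, q',
        fun x => if x ∈ (H.comp s.comp).reset e.2.2 then 0 else H.elapse s e.1 x⟩
    else none

/-- The three kinds of steps, before the invariant of the target location is taken into account. -/
noncomputable def rawStep (H : Automaton n) (s : Config n) (e : TimedAction) :
    Option (Config n) :=
  match s.loc with
  | .call b en => H.callStep s e b en
  | .node v => if v ∈ (H.comp s.comp).exits then H.returnStep s e v else H.internalStep s e
  | .ret _ _ => H.internalStep s e

/-- The labelled transition system of a recursive hybrid automaton. A configuration is a state only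
if it satisfies the invariant of its location, so a step to a configuration that violates it
does not exist. -/
noncomputable def lts (H : Automaton n) : LTS (Config n) TimedAction where
  trans s e :=
    open Classical in
    match H.rawStep s e with
    | none => none
    | some s' => if H.InInv s' then some s' else none

end Automaton

/-- The duration of a finite run: the sum of its delays. -/
noncomputable def duration (r : LTS.Run (Config n) TimedAction) : ℝ≥0 :=
  (r.past.map fun p => p.2.1).sum

/-! ### The time-bounded reachability game problem -/

/-- An input of the time-bounded reachability game problem. The initial valuation is rational and
given by numerators and denominators. -/
structure Instance (n : ℕ) where
  automaton : Automaton n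
  /-- the locations of Achilles, as pairs (component, location);
  all other locations belong to Tortoise -/
  achilles : List (ℕ × Loc)
  initComp : ℕ
  initNode : ℕ
  initVal : Fin n → ℤ × ℕ
  /-- the final locations -/
  final : List (ℕ × Loc)
  bound : ℕ

namespace Instance

/-- The initial configuration, with empty context. -/
noncomputable def init (I : Instance n) : Config n where
  ctx := []
  comp := I.initComp
  loc := .node I.initNode
  val x := ((I.initVal x).1 : ℝ) / ((I.initVal x).2 : ℝ)

/-- The configurations whose location is in the given list. -/
def atLoc (Q : List (ℕ × Loc)) : Set (Config n) := {s | (s.comp, s.loc) ∈ Q}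

/-- The data are a time-bounded reachability game on a recursive stopwatch automaton. There is no
restriction on which variables a box passes by value. -/
structure IsRSAGame (I : Instance n) : Prop where
  wellFormed : I.automaton.WellFormed
  stopwatch : I.automaton.IsStopwatch
  achilles : ∀ p ∈ I.achilles, I.automaton.IsLoc p.1 p.2
  final : ∀ p ∈ I.final, I.automaton.IsLoc p.1 p.2
  initNode : I.automaton.IsLoc I.initComp (.node I.initNode)
  initVal : ∀ x, (I.initVal x).2 ≠ 0
  initInv : I.automaton.InInv I.init

/-- Achilles has a strategy such that, whatever strategy Tortoise uses, a final location is reached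
within total time at most the bound. -/
def AchillesWins (I : Instance n) : Prop :=
  ∃ σ : I.automaton.lts.Strategy (atLoc I.achilles),
    ∀ τ : I.automaton.lts.Strategy (atLoc I.achilles)ᶜ,
      ∃ k : ℕ, (I.automaton.lts.play σ τ I.init k).last ∈ atLoc I.final ∧
        duration (I.automaton.lts.play σ τ I.init k) ≤ (I.bound : ℝ≥0)

end Instance

/-! ### Encoding of instances, so that they can be inputs of computable functions -/

def Rel.equiv : Rel ≃ Fin 5 where
  toFun r := match r with | .lt => 0 | .le => 1 | .eq => 2 | .ge => 3 | .gt => 4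
  invFun i := match i with | 0 => .lt | 1 => .le | 2 => .eq | 3 => .ge | 4 => .gt
  left_inv r := by cases r <;> rfl
  right_inv i := by fin_cases i <;> rfl

instance : Primcodable Rel := Primcodable.ofEquiv _ Rel.equiv

def Atom.equiv (n : ℕ) : Atom n ≃ Fin n × Rel × ℤ where
  toFun c := (c.var, c.rel, c.const)
  invFun p := ⟨p.1, p.2.1, p.2.2⟩

instance : Primcodable (Atom n) := Primcodable.ofEquiv _ (Atom.equiv n)

def Loc.equiv : Loc ≃ ℕ ⊕ (ℕ × ℕ) ⊕ (ℕ × ℕ) where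
  toFun q := match q with
    | .node v => .inl v
    | .call b en => .inr (.inl (b, en))
    | .ret b ex => .inr (.inr (b, ex))
  invFun p := match p with
    | .inl v => .node v
    | .inr (.inl (b, en)) => .call b en
    | .inr (.inr (b, ex)) => .ret b ex
  left_inv q := by cases q <;> rfl
  right_inv p := by rcases p with v | ⟨b, en⟩ | ⟨b, ex⟩ <;> rfl

instance : Primcodable Loc := Primcodable.ofEquiv _ Loc.equiv

def Component.equiv (n : ℕ) : Component n ≃
    ℕ × List ℕ × List ℕ × List (ℕ × List (Fin n)) × List (List (Fin n)) ×
      List ((Loc × ℕ) × Loc) × List ((Loc × ℕ) × Rect n) ×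
      List (Loc × Rect n) × List (Loc × (Fin n → ℕ)) where
  toFun C := (C.numNodes, C.entries, C.exits, C.boxes, C.resets, C.transTable, C.guardTable,
    C.invTable, C.flowTable)
  invFun p := ⟨p.1, p.2.1, p.2.2.1, p.2.2.2.1, p.2.2.2.2.1, p.2.2.2.2.2.1, p.2.2.2.2.2.2.1,
    p.2.2.2.2.2.2.2.1, p.2.2.2.2.2.2.2.2⟩

instance : Primcodable (Component n) := Primcodable.ofEquiv _ (Component.equiv n)

def Automaton.equiv (n : ℕ) : Automaton n ≃ List (Component n) where
  toFun H := H.comps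
  invFun l := ⟨l⟩

instance : Primcodable (Automaton n) := Primcodable.ofEquiv _ (Automaton.equiv n)

def Instance.equiv (n : ℕ) : Instance n ≃
    Automaton n × List (ℕ × Loc) × ℕ × ℕ × (Fin n → ℤ × ℕ) × List (ℕ × Loc) × ℕ where
  toFun I := (I.automaton, I.achilles, I.initComp, I.initNode, I.initVal, I.final, I.bound)
  invFun p := ⟨p.1, p.2.1, p.2.2.1, p.2.2.2.1, p.2.2.2.2.1, p.2.2.2.2.2.1, p.2.2.2.2.2.2⟩

instance : Primcodable (Instance n) := Primcodable.ofEquiv _ (Instance.equiv n)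

end RHA

/-! The domain of a partial recursive function is reduced to the game. A configuration with `Y > 0`
stands for the pair of reals `(X / Y, Z / Y)`, so `Y` is a unit that may be small, and the control
state names a binary relation to which Achilles claims that this pair belongs. The relations form
the least solution of a finite system `RelEq`. Union is a choice of Achilles and intersection a
choice of Tortoise, so a win amounts to a derivation of the claim. In `span` a further number `d`
occurs: the unit is put on the stack by a call that passes only `Y` by value, Achilles guesses `d`
in `Y`, Tortoise picks the half to be proved, the values are rearranged, and the return restores the
unit.

Copies are guesses that Tortoise may challenge, which ends the play with a check. Equality is
checked by running both stopwatches until both are `1`; `w = v₁ + v₂` by increasing `w` by `1 - v₁`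
and `1 - v₂` and comparing it with `2`. Moves of Tortoise are made urgent by a running stopwatch
that must stay at most `0`; its old value is on the stack meanwhile, so three stopwatches suffice.

Guessing a value costs that much time. On each play of a derivation the guesses cost at most `K *
Y`, plus at most `2` for the final check, but `K` depends on the derivation. Achilles therefore
first halves `X` and `Y` as often as necessary; this preserves the ratio, and the costs form a
geometric series. So a derivation gives a win in bounded time (`within_of_sem`,
`within_of_halving`), and conversely any win, even without a time bound, gives a derivation
(`exists_sem_of_force`). The lemmas `exists_forces` and `exists_strategy_of_forcesWithin` translate
between strategies and inductively defined forcing.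

The systems are expressive enough: `span` yields converses and compositions, and `Definable.linear`
yields the recursion `R ∪ S ; X ; T ⊆ X`. From these come pairing, primitive recursion and
minimization, hence all graphs of partial recursive functions (`definable_graph`). Automaton and
time bound are fixed for a given function; the input enters only through the initial valuation `X =
1`, `Y = 1 / (m + 1)`. -/

/-! ### Forcing a set of states, with and without a time budget -/

namespace LTS

variable {S A : Type}

/-- The player who controls `P` can force a visit to `F` within `n` steps, when the opponent is
restricted to the actions in `A₀`. -/
def Forces (L : LTS S A) (P F : Set S) (A₀ : Finset A) : ℕ → S → Prop
  | 0, s => s ∈ F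
  | n + 1, s => s ∈ F ∨ (s ∈ P ∧ ∃ a s', L.trans s a = some s' ∧ L.Forces P F A₀ n s') ∨
      (s ∉ P ∧ ∀ a ∈ A₀, ∀ s', L.trans s a = some s' → L.Forces P F A₀ n s')

/-- The player who controls `P` can force a visit to `F` within `n` steps at cost at most `c`. -/
def ForcesWithin (L : LTS S A) (P F : Set S) (cost : A → ℝ≥0) : ℕ → ℝ≥0 → S → Prop
  | 0, _, s => s ∈ F
  | n + 1, c, s => s ∈ F ∨
      (s ∈ P ∧ ∃ a s' c', L.trans s a = some s' ∧ cost a + c' ≤ c ∧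
        L.ForcesWithin P F cost n c' s') ∨
      (s ∉ P ∧ (∃ a, L.Avail s a) ∧ ∀ a s', L.trans s a = some s' →
        ∃ c', cost a + c' ≤ c ∧ L.ForcesWithin P F cost n c' s')

variable {L : LTS S A} {P F : Set S} {A₀ : Finset A} {cost : A → ℝ≥0}

theorem Forces.succ {n : ℕ} : ∀ {s : S}, L.Forces P F A₀ n s → L.Forces P F A₀ (n + 1) s := by
  induction n with
  | zero => exact fun h => .inl h
  | succ n ih =>
    rintro s (h | ⟨hs, a, s', h, h'⟩ | ⟨hs, h⟩)
    · exact .inl h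
    · exact .inr (.inl ⟨hs, a, s', h, ih h'⟩)
    · exact .inr (.inr ⟨hs, fun a ha s' h' => ih (h a ha s' h')⟩)

theorem Forces.mono {m n : ℕ} (hmn : m ≤ n) {s : S} (h : L.Forces P F A₀ m s) :
    L.Forces P F A₀ n s := by
  induction hmn with
  | refl => exact h
  | step _ ih => exact ih.succ

theorem ForcesWithin.succ {n : ℕ} : ∀ {c : ℝ≥0} {s : S}, L.ForcesWithin P F cost n c s →
    L.ForcesWithin P F cost (n + 1) c s := by
  induction n with
  | zero => exact fun h => .inl h
  | succ n ih =>
    rintro c s (h | ⟨hs, a, s', c', h, hc, h'⟩ | ⟨hs, hav, h⟩)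
    · exact .inl h
    · exact .inr (.inl ⟨hs, a, s', c', h, hc, ih h'⟩)
    · refine .inr (.inr ⟨hs, hav, fun a s' h' => ?_⟩)
      obtain ⟨c', hc, h''⟩ := h a s' h'
      exact ⟨c', hc, ih h''⟩

theorem ForcesWithin.mono {m n : ℕ} (hmn : m ≤ n) {c : ℝ≥0} {s : S}
    (h : L.ForcesWithin P F cost m c s) : L.ForcesWithin P F cost n c s := by
  induction hmn with
  | refl => exact h
  | step _ ih => exact ih.succ

theorem ForcesWithin.mono_cost {n : ℕ} {c d : ℝ≥0} (hcd : c ≤ d) {s : S}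
    (h : L.ForcesWithin P F cost n c s) : L.ForcesWithin P F cost n d s := by
  cases n with
  | zero => exact h
  | succ n =>
    obtain h | ⟨hs, a, s', c', h, hc, h'⟩ | ⟨hs, hav, h⟩ := h
    · exact .inl h
    · exact .inr (.inl ⟨hs, a, s', c', h, hc.trans hcd, h'⟩)
    · refine .inr (.inr ⟨hs, hav, fun a s' h' => ?_⟩)
      obtain ⟨c', hc, h''⟩ := h a s' h'
      exact ⟨c', hc.trans hcd, h''⟩

theorem play_succ_of_trans (σ : L.Strategy P) (τ : L.Strategy Pᶜ) {s : S} {k : ℕ} {a : A} {s' : S}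
    (ha : L.choice σ τ (L.play σ τ s k) = some a)
    (hs : L.trans (L.play σ τ s k).last a = some s') :
    L.play σ τ s (k + 1) = ⟨((L.play σ τ s k).last, a) :: (L.play σ τ s k).past, s'⟩ := by
  simp [play, ha, hs]

/-- A winning strategy forces a visit to `F` in boundedly many steps, against opponents with
finitely many actions. -/
theorem exists_forces (σ : L.Strategy P) (A₀ : Finset A) (s₀ : S)
    (hσ : ∀ τ : L.Strategy Pᶜ, ∃ k, (L.play σ τ s₀ k).last ∈ F) :
    ∃ n, L.Forces P F A₀ n s₀ := by
  classical
  by_contra! hs₀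
  let Safe : S → Prop := fun s => ∀ n, ¬ L.Forces P F A₀ n s
  let good : S → A → Prop := fun s a => ∃ s', L.trans s a = some s' ∧ Safe s'
  -- The opponent moves to a safe state, one from which no number of steps suffices, whenever there
  -- is such a successor.
  let τ : L.Strategy Pᶜ :=
    { act := fun r => if h : ∃ a, good r.last a then some h.choose
        else if h : ∃ a, L.Avail r.last a then some h.choose else none
      valid := by
        intro r _ hav
        by_cases h : ∃ a, good r.last a
        · obtain ⟨s', hs', _⟩ := h.choose_spec
          exact ⟨h.choose, by simp [h], s', hs'⟩
        · exact ⟨hav.choose, by simp [h, hav], hav.choose_spec⟩ }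
  have key : ∀ k, Safe (L.play σ τ s₀ k).last := by
    intro k
    induction k with
    | zero => exact hs₀
    | succ k ih =>
      rw [play]
      cases hc : L.choice σ τ (L.play σ τ s₀ k) with
      | none => exact ih
      | some a =>
        cases ht : L.trans (L.play σ τ s₀ k).last a with
        | none => simpa [ht] using ih
        | some s' =>
          simp only [ht]
          by_cases hP : (L.play σ τ s₀ k).last ∈ P
          · exact fun n hn => ih (n + 1) (.inr (.inl ⟨hP, a, s', ht, hn⟩))
          -- If no successor were safe, each action would have its own step bound, and the maximum
          -- over the finite set `A₀` would bound the steps from the present state. In particular a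
          -- safe state of the opponent is never stuck.
          · have hg : ∃ a, good (L.play σ τ s₀ k).last a := by
              by_contra! hno
              have : ∀ a, ∃ m, ∀ s', L.trans (L.play σ τ s₀ k).last a = some s' →
                  L.Forces P F A₀ m s' := by
                intro a
                cases ht : L.trans (L.play σ τ s₀ k).last a with
                | none => exact ⟨0, by simp⟩
                | some s' =>
                  have : ¬ Safe s' := fun h => hno a ⟨s', ht, h⟩
                  simp only [Safe, not_forall, not_not] at this
                  obtain ⟨m, hm⟩ := this
                  exact ⟨m, by rintro _ ⟨⟩; exact hm⟩
              choose m hm using this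
              exact ih (A₀.sup m + 1) (.inr (.inr ⟨hP, fun a ha s' hs' =>
                (hm a s' hs').mono (Finset.le_sup ha)⟩))
            have hcτ : L.choice σ τ (L.play σ τ s₀ k) = some hg.choose := by
              simp only [choice, hP, if_false, τ, dif_pos hg]
            obtain ⟨s'', hs'', hsafe⟩ := hg.choose_spec
            rw [hcτ, Option.some.injEq] at hc
            rw [hc, ht, Option.some.injEq] at hs''
            rwa [hs'']
  obtain ⟨k, hk⟩ := hσ τ
  exact key k 0 hk

/-- A player who can force a visit to `F` at cost at most `T` has a strategy that does so. -/
theorem exists_strategy_of_forcesWithin {n : ℕ} {T : ℝ≥0} {s₀ : S}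
    (h₀ : L.ForcesWithin P F cost n T s₀) :
    ∃ σ : L.Strategy P, ∀ τ : L.Strategy Pᶜ, ∃ k, (L.play σ τ s₀ k).last ∈ F ∧
      ((L.play σ τ s₀ k).past.map fun p => cost p.2).sum ≤ T := by
  classical
  let spent : Run S A → ℝ≥0 := fun r => (r.past.map fun p => cost p.2).sum
  let good : Run S A → ℕ → Prop := fun r n =>
    ∃ c, spent r + c ≤ T ∧ L.ForcesWithin P F cost n c r.last
  -- The new bound must lie below every bound that is good now, so the strategy need not remember
  -- which bound it pursues. An action that is optimal for the least good bound has this property.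
  let nice : Run S A → A → Prop := fun r a => ∃ s', L.trans r.last a = some s' ∧
    ∃ m, good ⟨(r.last, a) :: r.past, s'⟩ m ∧ ∀ n, good r n → m < n
  have spent_cons : ∀ (r : Run S A) (a : A) (s' : S),
      spent ⟨(r.last, a) :: r.past, s'⟩ = cost a + spent r := fun r a s' => by simp [spent]
  have hnice : ∀ r : Run S A, r.last ∈ P → r.last ∉ F → (∃ n, good r n) → ∃ a, nice r a := by
    intro r hP hF hex
    obtain ⟨c, hc, hw⟩ := Nat.find_spec hex
    have hmin : ∀ n, good r n → Nat.find hex ≤ n := fun n hn => Nat.find_min' hex hn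
    revert hw hmin
    cases Nat.find hex with
    | zero => exact fun hw => absurd hw hF
    | succ m =>
      rintro (hw | ⟨_, a, s', c', hs', hc', hw⟩ | ⟨hw, _⟩) hmin
      · exact absurd hw hF
      · refine ⟨a, s', hs', m, ⟨c', ?_, hw⟩, hmin⟩
        rw [spent_cons]
        calc cost a + spent r + c' = spent r + (cost a + c') := by ring
          _ ≤ spent r + c := by gcongr
          _ ≤ T := hc
      · exact absurd hP hw
  let σ : L.Strategy P :=
    { act := fun r => if h : ∃ a, nice r a then some h.choose
        else if h : ∃ a, L.Avail r.last a then some h.choose else none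
      valid := by
        intro r _ hav
        by_cases h : ∃ a, nice r a
        · obtain ⟨s', hs', _⟩ := h.choose_spec
          exact ⟨h.choose, by simp [h], s', hs'⟩
        · exact ⟨hav.choose, by simp [h, hav], hav.choose_spec⟩ }
  refine ⟨σ, fun τ => ?_⟩
  have key : ∀ n k, good (L.play σ τ s₀ k) n → ∃ k, (L.play σ τ s₀ k).last ∈ F ∧
      spent (L.play σ τ s₀ k) ≤ T := by
    intro n
    induction n using Nat.strong_induction_on with
    | _ n ih =>
      intro k hk
      by_cases hF : (L.play σ τ s₀ k).last ∈ F
      · obtain ⟨c, hc, -⟩ := hk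
        exact ⟨k, hF, le_trans le_self_add hc⟩
      by_cases hP : (L.play σ τ s₀ k).last ∈ P
      · have h := hnice _ hP hF ⟨n, hk⟩
        have hc : L.choice σ τ (L.play σ τ s₀ k) = some h.choose := by
          simp only [choice, hP, if_true, σ, dif_pos h]
        obtain ⟨s', hs', m, hm, hlt⟩ := h.choose_spec
        refine ih m (hlt n hk) (k + 1) ?_
        rw [play_succ_of_trans σ τ hc hs']
        exact hm
      · obtain ⟨c, hc, hw⟩ := hk
        cases n with
        | zero => exact absurd hw hF
        | succ n =>
          obtain hw | ⟨hw, _⟩ | ⟨-, hav, hw⟩ := hw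
          · exact absurd hw hF
          · exact absurd hw hP
          · obtain ⟨a, ha, s', hs'⟩ := τ.valid _ hP hav
            have hch : L.choice σ τ (L.play σ τ s₀ k) = some a := by
              simp only [choice, hP, if_false, ha]
            obtain ⟨c', hc', hw'⟩ := hw a s' hs'
            refine ih n n.lt_succ_self (k + 1) ?_
            rw [play_succ_of_trans σ τ hch hs']
            refine ⟨c', ?_, hw'⟩
            rw [spent_cons]
            calc cost a + spent (L.play σ τ s₀ k) + c'
                = spent (L.play σ τ s₀ k) + (cost a + c') := by ring
              _ ≤ spent (L.play σ τ s₀ k) + c := by gcongr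
              _ ≤ T := hc
  exact key n 0 ⟨T, by simp [spent, play], h₀⟩

end LTS

/-! ### Programs for recursive stopwatch automata -/

namespace List

/-- Serves to read the finite tables of an automaton as the functions that they tabulate. -/
theorem lookup_map_graph {K V : Type*} [BEq K] [LawfulBEq K] (f : K → V) (k : K) (l : List K) :
    (l.map fun k => (k, f k)).lookup k = if k ∈ l then some (f k) else none := by
  induction l with
  | nil => rfl
  | cons a l ih =>
    by_cases h : k = a
    · subst h; simp
    · have : (k == a) = false := by simpa using h
      simp [lookup_cons, this, ih, h]

theorem lookup_filterMap_graph {K V : Type*} [BEq K] [LawfulBEq K] (f : K → Option V) (k : K)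
    (l : List K) :
    (l.filterMap fun k => (f k).map fun v => (k, v)).lookup k = if k ∈ l then f k else none := by
  induction l with
  | nil => rfl
  | cons a l ih =>
    by_cases h : k = a
    · subst h
      cases hf : f k with
      | none => simp [hf, ih]
      | some v => simp [hf]
    · have hb : (k == a) = false := by simpa using h
      cases hf : f a with
      | none => simp [hf, ih, h]
      | some v => simp [hf, lookup_cons, hb, ih, h]

end List

namespace RHA

/-- Instructions of a program with the set `Q` of states and `n` stopwatches. -/
inductive Ins (n : ℕ) (Q : Type)
  /-- set `v` to `0` -/
  | reset (v : Fin n) (j : Q)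
  /-- let the variables in `S` run, until a time chosen by Achilles at which `G` holds -/
  | run (S : List (Fin n)) (G : Rect n) (j : Q)
  /-- Achilles chooses the next state -/
  | fork (j k : Q)
  /-- Tortoise chooses the next state, while the running variable `w` is at most `0` -/
  | ask (w : Fin n) (j k : Q)
  /-- call the program recursively, passing only `v` by value -/
  | push (v : Fin n) (j : Q)
  /-- return from the last call -/
  | pop (k : Q)
  | halt

/-! ### Translation of a program into an automaton with one component -/

namespace Ins

variable {n : ℕ} {Q : Type} [Fintype Q]

noncomputable def code (q : Q) : ℕ := Fintype.equivFin Q q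

noncomputable def decode (Q : Type) [Fintype Q] (i : ℕ) : Option Q :=
  if h : i < Fintype.card Q then some ((Fintype.equivFin Q).symm ⟨i, h⟩) else none

theorem code_lt (q : Q) : code q < Fintype.card Q := (Fintype.equivFin Q q).2

@[simp] theorem decode_code (q : Q) : decode Q (code q) = some q := by
  rw [decode, dif_pos (code_lt q)]
  simp [code]

theorem eq_code_of_decode {i : ℕ} {q : Q} (h : decode Q i = some q) : i = code q := by
  unfold decode at h
  split at h
  · simp only [Option.some.injEq] at h
    simp [code, ← h]
  · simp at h

theorem code_injective : Function.Injective (code : Q → ℕ) := fun q r h => by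
  simpa using congrArg (decode Q) h

variable (p : Q → Ins n Q)

/-- After a return the play continues where the exit node `pop k` says, not where the call was made.
The stack thus only stores values, and apart from it a program is a flow chart. Action `v + 2` is
the one that resets `v`. -/
noncomputable def next : Loc → ℕ → Option Loc
  | .node i, a => match (decode Q i).map p with
    | some (.reset v j) => if a = v + 2 then some (.node (code j)) else none
    | some (.run _ _ j) => if a = 0 then some (.node (code j)) else none
    | some (.fork j k) => if a = 0 then some (.node (code j)) else
        if a = 1 then some (.node (code k)) else none
    | some (.ask _ j k) => if a = 0 then some (.node (code j)) else
        if a = 1 then some (.node (code k)) else none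
    | some (.push v j) => if a = 0 then some (.call v (code j)) else none
    | _ => none
  | .ret b i, a => match (decode Q i).map p with
    | some (.pop k) => if a = 0 ∧ b < n then some (.node (code k)) else none
    | _ => none
  | .call _ _, _ => none

noncomputable def rate : Loc → Fin n → ℕ
  | .node i => match (decode Q i).map p with
    | some (.run S _ _) => fun x => if x ∈ S then 1 else 0
    | some (.ask w _ _) => fun x => if x = w then 1 else 0
    | _ => 0
  | _ => 0

noncomputable def invariant : Loc → Rect n
  | .node i => match (decode Q i).map p with
    | some (.ask w _ _) => [⟨w, .le, 0⟩]
    | _ => []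
  | _ => []

noncomputable def guard : Loc → Rect n
  | .node i => match (decode Q i).map p with
    | some (.run _ G _) => G
    | _ => []
  | _ => []

noncomputable def isPop (i : ℕ) : Bool := match (decode Q i).map p with
  | some (.pop _) => true
  | _ => false

/-- All potential locations. -/
noncomputable def locs (n : ℕ) (Q : Type) [Fintype Q] : List Loc :=
  (List.range (Fintype.card Q)).map .node ++
    ((List.range n ×ˢ List.range (Fintype.card Q)).map fun c => .call c.1 c.2) ++
    ((List.range n ×ˢ List.range (Fintype.card Q)).map fun c => .ret c.1 c.2)

/-- All boxes lead back to the component itself, and each variable has a box that passes only this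
variable by value. States that are not exits may all serve as entries, so the two sets are disjoint
by construction. -/
noncomputable def component : Component n where
  numNodes := Fintype.card Q
  entries := (List.range (Fintype.card Q)).filter fun i => !isPop p i
  exits := (List.range (Fintype.card Q)).filter fun i => isPop p i
  boxes := (List.finRange n).map fun v => (0, [v])
  resets := [] :: [] :: (List.finRange n).map fun v => [v]
  transTable := (locs n Q ×ˢ List.range (n + 2)).filterMap fun k =>
    (next p k.1 k.2).map fun q => (k, q)
  guardTable := (locs n Q ×ˢ List.range (n + 2)).map fun k => (k, guard p k.1)
  invTable := (locs n Q).map fun q => (q, invariant p q)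
  flowTable := (locs n Q).map fun q => (q, rate p q)

noncomputable def automaton : Automaton n := ⟨[component p]⟩

@[simp] theorem comp_automaton : (automaton p).comp 0 = component p := rfl

@[simp] theorem length_comps : (automaton p).comps.length = 1 := rfl

theorem node_mem_locs {i : ℕ} : .node i ∈ locs n Q ↔ i < Fintype.card Q := by
  simp [locs]

theorem call_mem_locs {b i : ℕ} : .call b i ∈ locs n Q ↔ b < n ∧ i < Fintype.card Q := by
  simp [locs]

theorem ret_mem_locs {b i : ℕ} : .ret b i ∈ locs n Q ↔ b < n ∧ i < Fintype.card Q := by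
  simp [locs]

theorem lt_card_of_decode {i : ℕ} {x : Ins n Q} (h : (decode Q i).map p = some x) :
    i < Fintype.card Q := by
  unfold decode at h
  split at h
  · assumption
  · simp at h

theorem exists_code_of_decode {i : ℕ} {x : Ins n Q} (h : (decode Q i).map p = some x) :
    ∃ q, i = code q ∧ p q = x := by
  obtain ⟨q, hq, hx⟩ := Option.map_eq_some_iff.1 h
  exact ⟨q, eq_code_of_decode hq, hx⟩

theorem mem_of_next {q : Loc} {a : ℕ} {q' : Loc} (h : next p q a = some q') :
    q ∈ locs n Q ∧ a < n + 2 := by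
  unfold next at h
  split at h
  · rw [node_mem_locs]
    split at h <;> rename_i hd
    · have := lt_card_of_decode p hd
      split_ifs at h; omega
    · have := lt_card_of_decode p hd
      split_ifs at h; omega
    · have := lt_card_of_decode p hd
      split_ifs at h <;> omega
    · have := lt_card_of_decode p hd
      split_ifs at h <;> omega
    · have := lt_card_of_decode p hd
      split_ifs at h; omega
    · simp at h
  · rw [ret_mem_locs]
    split at h <;> rename_i hd
    · have := lt_card_of_decode p hd
      split_ifs at h; omega
    · simp at h
  · simp at h

@[simp] theorem tr_component (q : Loc) (a : ℕ) : (component p).tr q a = next p q a := by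
  unfold Component.tr component
  dsimp only
  have h := List.lookup_filterMap_graph (fun k : Loc × ℕ => next p k.1 k.2) (q, a)
    (locs n Q ×ˢ List.range (n + 2))
  rw [h]
  split_ifs with hk
  · rfl
  · cases hn : next p q a with
    | none => rfl
    | some q' =>
      have := mem_of_next p hn
      simp [this] at hk

theorem mem_locs_of_guard {q : Loc} (h : guard p q ≠ []) : q ∈ locs n Q := by
  unfold guard at h
  split at h
  · split at h <;> rename_i hd
    · exact node_mem_locs.2 (lt_card_of_decode p hd)
    · simp at h
  · simp at h

@[simp] theorem guard_component (q : Loc) (a : ℕ) (ha : a < n + 2) :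
    (component p).guard q a = guard p q := by
  unfold Component.guard component
  dsimp only
  have h := List.lookup_map_graph (fun k : Loc × ℕ => guard p k.1) (q, a)
    (locs n Q ×ˢ List.range (n + 2))
  rw [h]
  split_ifs with hk
  · rfl
  · by_contra hne
    have := mem_locs_of_guard p (q := q) fun h => hne (by simp [h])
    simp [this, ha] at hk

theorem mem_locs_of_invariant {q : Loc} (h : invariant p q ≠ []) : q ∈ locs n Q := by
  unfold invariant at h
  split at h
  · split at h <;> rename_i hd
    · exact node_mem_locs.2 (lt_card_of_decode p hd)
    · simp at h
  · simp at h

@[simp] theorem inv_component (q : Loc) : (component p).inv q = invariant p q := by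
  unfold Component.inv component
  dsimp only
  rw [List.lookup_map_graph (fun k : Loc => invariant p k)]
  split_ifs with hk
  · rfl
  · by_contra hne
    exact hk (mem_locs_of_invariant p fun h => hne (by simp [h]))

theorem flow_component (q : Loc) (hq : q ∈ locs n Q) : (component p).flow q = rate p q := by
  unfold Component.flow component
  dsimp only
  rw [List.lookup_map_graph (fun k : Loc => rate p k), if_pos hq]
  rfl

theorem rate_eq (q : Loc) (x : Fin n) : rate p q x = 0 ∨ rate p q x = 1 := by
  cases q with
  | node i =>
    simp only [rate]
    cases (decode Q i).map p with
    | none => simp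
    | some y =>
      cases y <;> dsimp only <;> try split_ifs
      all_goals simp
  | _ => simp [rate]

@[simp] theorem target_component (b : ℕ) : (component p).target b = 0 := by
  simp only [Component.target, component, List.getD_eq_getElem?_getD, List.getElem?_map]
  cases (List.finRange n)[b]? <;> rfl

@[simp] theorem byValue_component (v : Fin n) : (component p).byValue v = [v] := by
  simp [Component.byValue, component]

@[simp] theorem reset_component_zero : (component p).reset 0 = [] := rfl

@[simp] theorem reset_component_one : (component p).reset 1 = [] := rfl

@[simp] theorem reset_component (v : Fin n) : (component p).reset (v + 2) = [v] := by
  simp [Component.reset, component]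

@[simp] theorem length_resets : (component p).resets.length = n + 2 := by
  simp [component]

@[simp] theorem length_boxes : (component p).boxes.length = n := by
  simp [component]

@[simp] theorem isPop_code (q : Q) : isPop p (code q) = true ↔ ∃ k, p q = .pop k := by
  simp only [isPop, decode_code, Option.map_some]
  cases p q <;> simp

theorem code_mem_exits (q : Q) : code q ∈ (component p).exits ↔ ∃ k, p q = .pop k := by
  simp [component, code_lt]

theorem code_mem_entries (q : Q) : code q ∈ (component p).entries ↔ ∀ k, p q ≠ .pop k := by
  have := isPop_code p q
  simp only [component, List.mem_filter, List.mem_range, code_lt, true_and]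
  cases h : isPop p (code q) <;> simp_all

/-- No call leads to a return instruction. -/
def Callable : Prop := ∀ q v j, p q = .push v j → ∀ k, p j ≠ .pop k

theorem wellFormed (hp : Callable p) : (automaton p).WellFormed where
  entries i hi v hv := by
    obtain rfl : i = 0 := by simpa using hi
    have : v ∈ (component p).entries := hv
    simp [component] at this
    exact this.1
  exits i hi v hv := by
    obtain rfl : i = 0 := by simpa using hi
    have : v ∈ (component p).exits := hv
    simp [component] at this
    exact this.1
  disjoint i hi v hv := by
    obtain rfl : i = 0 := by simpa using hi
    have : v ∈ (component p).entries := hv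
    simp only [comp_automaton, component, List.mem_filter] at this ⊢
    simp_all
  boxes i hi b hb := by
    obtain rfl : i = 0 := by simpa using hi
    simp
  trans i hi q a q' h := by
    obtain rfl : i = 0 := by simpa using hi
    have hn : next p q a = some q' := by
      simp only [comp_automaton, component, List.mem_filterMap, Option.map_eq_some_iff] at h
      obtain ⟨k, -, x, hx, he⟩ := h
      simp only [Prod.mk.injEq] at he
      obtain ⟨rfl, rfl⟩ := he
      exact hx
    have hnode : ∀ j : Q, (automaton p).IsLoc 0 (.node (code j)) := fun j =>
      ⟨by simp, code_lt j⟩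
    obtain ⟨hq, ha⟩ := mem_of_next p hn
    have hex : ∀ q : Q, (∀ k, p q ≠ .pop k) → (automaton p).IsInternal 0 (.node (code q)) := by
      intro q hq
      rw [Automaton.IsInternal, comp_automaton, code_mem_exits]
      simpa using hq
    rw [comp_automaton, length_resets]
    suffices (automaton p).IsLoc 0 q ∧ (automaton p).IsInternal 0 q ∧ (automaton p).IsLoc 0 q' from
      ⟨this.1, this.2.1, ha, this.2.2⟩
    unfold next at hn
    split at hn
    · split at hn <;> try rename_i hd
      all_goals try (obtain ⟨q, rfl, hpq⟩ := exists_code_of_decode p hd)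
      · split_ifs at hn
        cases hn
        exact ⟨hnode _, hex _ (by simp [hpq]), hnode _⟩
      · split_ifs at hn
        cases hn
        exact ⟨hnode _, hex _ (by simp [hpq]), hnode _⟩
      · split_ifs at hn <;> cases hn <;> exact ⟨hnode _, hex _ (by simp [hpq]), hnode _⟩
      · split_ifs at hn <;> cases hn <;> exact ⟨hnode _, hex _ (by simp [hpq]), hnode _⟩
      · split_ifs at hn
        cases hn
        refine ⟨hnode _, hex _ (by simp [hpq]), by simp, by simp, ?_⟩
        rw [comp_automaton, target_component, comp_automaton, code_mem_entries]
        exact hp _ _ _ hpq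
      · simp at hn
    · split at hn
      · rename_i hd
        obtain ⟨q, rfl, hpq⟩ := exists_code_of_decode p hd
        split_ifs at hn with hb
        cases hn
        refine ⟨⟨by simp, by simpa using hb.2, ?_⟩, trivial, hnode _⟩
        rw [comp_automaton, target_component, comp_automaton, code_mem_exits]
        exact ⟨_, hpq⟩
      · simp at hn
    · simp at hn

theorem mem_locs_of_isLoc {q : Loc} (h : (automaton p).IsLoc 0 q) : q ∈ locs n Q := by
  cases q with
  | node i => exact node_mem_locs.2 h.2
  | call b i =>
    obtain ⟨-, hb, hi⟩ := h
    rw [comp_automaton, length_boxes] at hb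
    rw [comp_automaton, target_component, comp_automaton] at hi
    simp only [component, List.mem_filter, List.mem_range] at hi
    exact call_mem_locs.2 ⟨hb, hi.1⟩
  | ret b i =>
    obtain ⟨-, hb, hi⟩ := h
    rw [comp_automaton, length_boxes] at hb
    rw [comp_automaton, target_component, comp_automaton] at hi
    simp only [component, List.mem_filter, List.mem_range] at hi
    exact ret_mem_locs.2 ⟨hb, hi.1⟩

theorem isStopwatch : (automaton p).IsStopwatch := by
  intro i q hq x
  have hi : i < 1 := by cases q <;> exact hq.1
  obtain rfl : i = 0 := by simpa using hi
  rw [comp_automaton, flow_component p q (mem_locs_of_isLoc p hq)]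
  exact rate_eq p q x

/-! #### Transitions -/

/-- The configuration in the state `q`. -/
noncomputable def cfg (κ : List ((ℕ × ℕ) × (Fin n → ℝ))) (q : Q) (ν : Fin n → ℝ) : Config n :=
  ⟨κ, 0, .node (code q), ν⟩

/-- The valuation `ν` satisfies the invariant of the state `q`. -/
def Ok (q : Q) (ν : Fin n → ℝ) : Prop := ∀ w j k, p q = .ask w j k → ν w ≤ 0

variable {p} {κ : List ((ℕ × ℕ) × (Fin n → ℝ))} {ν : Fin n → ℝ} {q j k : Q} {v w : Fin n}
  {S : List (Fin n)} {G : Rect n}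

theorem sat_nil : sat ([] : Rect n) = Set.univ := by simp [sat]

theorem inInv_cfg : (automaton p).InInv (cfg κ q ν) ↔ Ok p q ν := by
  simp only [Automaton.InInv, cfg, comp_automaton, inv_component, invariant, decode_code,
    Option.map_some, Ok]
  cases p q <;> simp [sat, Rel.Holds]

theorem trans_eq_some {H : Automaton n} {s s' : Config n} {e : TimedAction} :
    H.lts.trans s e = some s' ↔ H.rawStep s e = some s' ∧ H.InInv s' := by
  simp only [Automaton.lts]
  cases H.rawStep s e with
  | none => simp
  | some s'' =>
    dsimp only
    split_ifs with h
    · simp only [Option.some.injEq]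
      constructor
      · rintro rfl; exact ⟨rfl, h⟩
      · exact fun h => h.1
    · simp only [false_iff, not_and, Option.some.injEq]
      rintro rfl; exact h

theorem internalStep_eq_some {H : Automaton n} {s s' : Config n} {e : TimedAction} :
    H.internalStep s e = some s' ↔ ∃ q', (H.comp s.comp).tr s.loc e.2.2 = some q' ∧
      (e.2.1 = s.comp ∧
        (∀ t' : ℝ≥0, t' ≤ e.1 → H.elapse s t' ∈ sat ((H.comp s.comp).inv s.loc)) ∧
        H.elapse s e.1 ∈ sat ((H.comp s.comp).guard s.loc e.2.2)) ∧
      s' = ⟨s.ctx, s.comp, q',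
        fun x => if x ∈ (H.comp s.comp).reset e.2.2 then 0 else H.elapse s e.1 x⟩ := by
  simp only [Automaton.internalStep]
  cases (H.comp s.comp).tr s.loc e.2.2 with
  | none => simp
  | some q'' =>
    dsimp only
    split_ifs with h
    · simp only [Option.some.injEq, exists_eq_left', iff_true_intro h, true_and]
      exact eq_comm
    · simp [h]

theorem rawStep_cfg (hq : ∀ k, p q ≠ .pop k) (e : TimedAction) :
    (automaton p).rawStep (cfg κ q ν) e = (automaton p).internalStep (cfg κ q ν) e := by
  have : code q ∉ (component p).exits := by rw [code_mem_exits]; simpa using hq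
  simp [Automaton.rawStep, cfg, this]

theorem elapse_of_rate_zero {q : Loc} (hq : q ∈ locs n Q) (h : rate p q = 0) (t : ℝ≥0) :
    (automaton p).elapse ⟨κ, 0, q, ν⟩ t = ν := by
  ext x
  simp [Automaton.elapse, flow_component p q hq, h]

theorem rate_node (q : Q) : rate p (.node (code q)) = match p q with
    | .run S _ _ => fun x => if x ∈ S then 1 else 0
    | .ask w _ _ => fun x => if x = w then 1 else 0
    | _ => 0 := by
  simp only [rate, decode_code, Option.map_some]
  cases p q <;> rfl

theorem code_mem_locs (q : Q) : Loc.node (code q) ∈ locs n Q := node_mem_locs.2 (code_lt q)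

/-- Common form of the steps that are neither calls nor returns; `μ` is the flow of the location,
which each instruction supplies. The guard table lists only actions below `n + 2`, but no other
action has a transition. -/
theorem trans_internal {l : Loc} {t : ℝ≥0} {c a : ℕ} {s' : Config n} (μ : ℝ≥0 → Fin n → ℝ)
    (hl : ∀ e, (automaton p).rawStep ⟨κ, 0, l, ν⟩ e = (automaton p).internalStep ⟨κ, 0, l, ν⟩ e)
    (hμ : ∀ t, (automaton p).elapse ⟨κ, 0, l, ν⟩ t = μ t) :
    (automaton p).lts.trans ⟨κ, 0, l, ν⟩ (t, c, a) = some s' ↔ ∃ l', next p l a = some l' ∧ c = 0 ∧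
      (∀ t' ≤ t, μ t' ∈ sat (invariant p l)) ∧ μ t ∈ sat (guard p l) ∧
      s' = ⟨κ, 0, l', fun x => if x ∈ (component p).reset a then 0 else μ t x⟩ ∧
      (automaton p).InInv s' := by
  rw [trans_eq_some, hl, internalStep_eq_some]
  simp only [hμ, comp_automaton, tr_component, inv_component]
  constructor
  · rintro ⟨⟨l', hl', ⟨hc, hi, hg⟩, hs'⟩, hinv⟩
    rw [guard_component p _ _ (mem_of_next p hl').2] at hg
    exact ⟨l', hl', hc, hi, hg, hs', hinv⟩
  · rintro ⟨l', hl', hc, hi, hg, hs', hinv⟩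
    rw [← guard_component p _ _ (mem_of_next p hl').2] at hg
    exact ⟨⟨l', hl', ⟨hc, hi, hg⟩, hs'⟩, hinv⟩

theorem trans_reset (h : p q = .reset v j) {e : TimedAction} {s' : Config n} :
    (automaton p).lts.trans (cfg κ q ν) e = some s' ↔ e.2 = (0, v.val + 2) ∧
      s' = cfg κ j (Function.update ν v 0) ∧ Ok p j (Function.update ν v 0) := by
  obtain ⟨t, c, a⟩ := e
  rw [cfg, trans_internal (fun _ => ν) (rawStep_cfg (by simp [h]))
    (elapse_of_rate_zero (code_mem_locs q) (by rw [rate_node, h]))]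
  have hup : (fun x => if x ∈ [v] then 0 else ν x) = Function.update ν v 0 := by
    ext x; simp [Function.update_apply]
  simp only [next, invariant, guard, decode_code, Option.map_some, h, sat_nil, Set.mem_univ,
    true_and, implies_true, Prod.mk.injEq]
  constructor
  · rintro ⟨l', hl', rfl, rfl, hinv⟩
    split_ifs at hl' with ha
    cases hl'
    subst ha
    rw [reset_component, hup] at hinv ⊢
    exact ⟨⟨rfl, rfl⟩, rfl, inInv_cfg.1 hinv⟩
  · rintro ⟨⟨rfl, rfl⟩, rfl, hok⟩
    refine ⟨_, if_pos rfl, rfl, ?_, inInv_cfg.2 hok⟩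
    rw [reset_component, hup, cfg]

/-- The valuation after the variables in `S` have been running for time `t`. -/
noncomputable def advance (ν : Fin n → ℝ) (S : List (Fin n)) (t : ℝ≥0) : Fin n → ℝ :=
  fun x => if x ∈ S then ν x + t else ν x

@[simp] theorem advance_nil (t : ℝ≥0) : advance ν [] t = ν := by
  ext x; simp [advance]

theorem trans_run (h : p q = .run S G j) {e : TimedAction} {s' : Config n} :
    (automaton p).lts.trans (cfg κ q ν) e = some s' ↔ e.2 = (0, 0) ∧ advance ν S e.1 ∈ sat G ∧
      s' = cfg κ j (advance ν S e.1) ∧ Ok p j (advance ν S e.1) := by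
  have hel : ∀ t, (automaton p).elapse (cfg κ q ν) t = advance ν S t := by
    intro t
    ext x
    simp only [Automaton.elapse, cfg, comp_automaton, flow_component p _ (code_mem_locs q),
      rate_node, h, advance]
    split_ifs <;> simp
  obtain ⟨t, c, a⟩ := e
  rw [cfg, trans_internal (advance ν S) (rawStep_cfg (by simp [h])) hel]
  simp only [next, invariant, guard, decode_code, Option.map_some, h, sat_nil, Set.mem_univ,
    true_and, implies_true, Prod.mk.injEq]
  constructor
  · rintro ⟨l', hl', rfl, hG, rfl, hinv⟩
    split_ifs at hl' with ha
    cases hl'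
    subst ha
    exact ⟨⟨rfl, rfl⟩, hG, rfl, inInv_cfg.1 hinv⟩
  · rintro ⟨⟨rfl, rfl⟩, hG, rfl, hok⟩
    exact ⟨_, if_pos rfl, rfl, hG, rfl, inInv_cfg.2 hok⟩

theorem trans_fork (h : p q = .fork j k) {e : TimedAction} {s' : Config n} :
    (automaton p).lts.trans (cfg κ q ν) e = some s' ↔
      (e.2 = (0, 0) ∧ s' = cfg κ j ν ∧ Ok p j ν) ∨ (e.2 = (0, 1) ∧ s' = cfg κ k ν ∧ Ok p k ν) := by
  obtain ⟨t, c, a⟩ := e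
  rw [cfg, trans_internal (fun _ => ν) (rawStep_cfg (by simp [h]))
    (elapse_of_rate_zero (code_mem_locs q) (by rw [rate_node, h]))]
  simp only [next, invariant, guard, decode_code, Option.map_some, h, sat_nil, Set.mem_univ,
    true_and, implies_true, Prod.mk.injEq]
  constructor
  · rintro ⟨l', hl', rfl, rfl, hinv⟩
    split_ifs at hl' with ha ha' <;> cases hl'
    · subst ha
      exact .inl ⟨⟨rfl, rfl⟩, rfl, inInv_cfg.1 hinv⟩
    · subst ha'
      exact .inr ⟨⟨rfl, rfl⟩, rfl, inInv_cfg.1 hinv⟩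
  · rintro (⟨⟨rfl, rfl⟩, rfl, hok⟩ | ⟨⟨rfl, rfl⟩, rfl, hok⟩)
    · exact ⟨_, if_pos rfl, rfl, rfl, inInv_cfg.2 hok⟩
    · exact ⟨.node (code k), by simp, rfl, rfl, inInv_cfg.2 hok⟩

/-- Urgency: `w` starts at `0`, grows at rate 1 and must stay at most `0`, so a positive delay
violates the invariant. Tortoise therefore cannot use up the time of Achilles. -/
theorem trans_ask (h : p q = .ask w j k) (hw : ν w = 0) {e : TimedAction} {s' : Config n} :
    (automaton p).lts.trans (cfg κ q ν) e = some s' ↔ e.1 = 0 ∧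
      ((e.2 = (0, 0) ∧ s' = cfg κ j ν ∧ Ok p j ν) ∨
        (e.2 = (0, 1) ∧ s' = cfg κ k ν ∧ Ok p k ν)) := by
  have hel : ∀ t, (automaton p).elapse (cfg κ q ν) t = advance ν [w] t := by
    intro t
    ext x
    simp only [Automaton.elapse, cfg, comp_automaton, flow_component p _ (code_mem_locs q),
      rate_node, h, advance]
    by_cases hx : x = w <;> simp [hx]
  have hadv : advance ν [w] 0 = ν := by ext x; simp [advance]
  have hsat : ∀ t, advance ν [w] t ∈ sat [⟨w, .le, 0⟩] ↔ t = 0 := by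
    intro t
    have : (t : ℝ) ≤ 0 ↔ t = 0 := by rw [← NNReal.coe_zero, NNReal.coe_le_coe, nonpos_iff_eq_zero]
    simpa [sat, Rel.Holds, advance, hw] using this
  obtain ⟨t, c, a⟩ := e
  rw [cfg, trans_internal (advance ν [w]) (rawStep_cfg (by simp [h])) hel]
  simp only [next, invariant, guard, decode_code, Option.map_some, h, sat_nil, Set.mem_univ,
    true_and, Prod.mk.injEq, hsat]
  constructor
  · rintro ⟨l', hl', rfl, ht, rfl, hinv⟩
    obtain rfl := ht t le_rfl
    refine ⟨rfl, ?_⟩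
    split_ifs at hl' with ha ha' <;> cases hl'
    · subst ha
      simp only [reset_component_zero, List.not_mem_nil, if_false, hadv] at hinv ⊢
      exact .inl ⟨by simp, rfl, inInv_cfg.1 hinv⟩
    · subst ha'
      simp only [reset_component_one, List.not_mem_nil, if_false, hadv] at hinv ⊢
      exact .inr ⟨by simp, rfl, inInv_cfg.1 hinv⟩
  · rintro ⟨rfl, ⟨⟨rfl, rfl⟩, rfl, hok⟩ | ⟨⟨rfl, rfl⟩, rfl, hok⟩⟩
    · refine ⟨_, if_pos rfl, rfl, fun t ht => le_antisymm ht zero_le, ?_, inInv_cfg.2 hok⟩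
      simp [hadv, cfg]
    · refine ⟨.node (code k), by simp, rfl, fun t ht => le_antisymm ht zero_le, ?_,
        inInv_cfg.2 hok⟩
      simp [hadv, cfg]

theorem inInv_call {b i : ℕ} : (automaton p).InInv ⟨κ, 0, .call b i, ν⟩ := by
  simp [Automaton.InInv, invariant, sat_nil]

theorem inInv_ret {b i : ℕ} : (automaton p).InInv ⟨κ, 0, .ret b i, ν⟩ := by
  simp [Automaton.InInv, invariant, sat_nil]

theorem trans_push (h : p q = .push v j) {e : TimedAction} {s' : Config n} :
    (automaton p).lts.trans (cfg κ q ν) e = some s' ↔ e.2 = (0, 0) ∧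
      s' = ⟨κ, 0, .call v (code j), ν⟩ := by
  obtain ⟨t, c, a⟩ := e
  rw [cfg, trans_internal (fun _ => ν) (rawStep_cfg (by simp [h]))
    (elapse_of_rate_zero (code_mem_locs q) (by rw [rate_node, h]))]
  simp only [next, invariant, guard, decode_code, Option.map_some, h, sat_nil, Set.mem_univ,
    true_and, implies_true, Prod.mk.injEq]
  constructor
  · rintro ⟨l', hl', rfl, rfl, -⟩
    split_ifs at hl' with ha
    cases hl'
    subst ha
    exact ⟨⟨rfl, rfl⟩, rfl⟩
  · rintro ⟨⟨rfl, rfl⟩, rfl⟩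
    exact ⟨_, if_pos rfl, rfl, rfl, inInv_call⟩

theorem isAction_iff (a : ℕ × ℕ) : (automaton p).IsAction a ↔ a.1 = 0 ∧ a.2 < n + 2 := by
  unfold Automaton.IsAction
  rw [length_comps, Nat.lt_one_iff]
  refine and_congr_right fun h => ?_
  rw [h, comp_automaton, length_resets]

theorem trans_call {e : TimedAction} {s' : Config n} :
    (automaton p).lts.trans ⟨κ, 0, .call v (code j), ν⟩ e = some s' ↔
      (e.1 = 0 ∧ e.2.1 = 0 ∧ e.2.2 < n + 2) ∧ s' = cfg (((0, v.val), ν) :: κ) j ν ∧ Ok p j ν := by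
  rw [trans_eq_some]
  simp only [Automaton.rawStep, Automaton.callStep, isAction_iff, comp_automaton, target_component]
  split_ifs with he
  · simp only [Option.some.injEq]
    constructor
    · rintro ⟨rfl, h⟩
      exact ⟨he, rfl, inInv_cfg.1 h⟩
    · rintro ⟨-, rfl, h⟩
      exact ⟨rfl, inInv_cfg.2 h⟩
  · simp [he]

theorem trans_pop (h : p q = .pop k) {ν₀ : Fin n → ℝ} {e : TimedAction} {s' : Config n} :
    (automaton p).lts.trans (cfg (((0, v.val), ν₀) :: κ) q ν) e = some s' ↔
      (e.1 = 0 ∧ e.2.1 = 0 ∧ e.2.2 < n + 2) ∧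
        s' = ⟨κ, 0, .ret v (code q), Function.update ν v (ν₀ v)⟩ := by
  have hup : (fun x => if x ∈ [v] then ν₀ x else ν x) = Function.update ν v (ν₀ v) := by
    ext x
    by_cases hx : x = v
    · subst hx; simp
    · simp [hx]
  have hex : code q ∈ (component p).exits := (code_mem_exits p q).2 ⟨k, h⟩
  rw [trans_eq_some]
  simp only [Automaton.rawStep, cfg, comp_automaton, hex, if_true, Automaton.returnStep,
    isAction_iff, target_component, byValue_component, and_true, hup]
  split_ifs with he
  · simp only [Option.some.injEq]
    constructor
    · rintro ⟨rfl, -⟩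
      exact ⟨he, rfl⟩
    · rintro ⟨-, rfl⟩
      exact ⟨rfl, inInv_ret⟩
  · simp [he]

theorem trans_ret (h : p q = .pop k) {e : TimedAction} {s' : Config n} :
    (automaton p).lts.trans ⟨κ, 0, .ret v (code q), ν⟩ e = some s' ↔ e.2 = (0, 0) ∧
      s' = cfg κ k ν ∧ Ok p k ν := by
  obtain ⟨t, c, a⟩ := e
  rw [trans_internal (fun _ => ν) (fun _ => rfl)
    (elapse_of_rate_zero (ret_mem_locs.2 ⟨v.2, code_lt q⟩) rfl)]
  simp only [next, invariant, guard, decode_code, Option.map_some, h, sat_nil, Set.mem_univ,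
    true_and, implies_true, Prod.mk.injEq]
  constructor
  · rintro ⟨l', hl', rfl, rfl, hinv⟩
    split_ifs at hl' with ha
    cases hl'
    obtain rfl := ha.1
    exact ⟨⟨rfl, rfl⟩, rfl, inInv_cfg.1 hinv⟩
  · rintro ⟨⟨rfl, rfl⟩, rfl, hok⟩
    exact ⟨_, if_pos ⟨rfl, v.2⟩, rfl, rfl, inInv_cfg.2 hok⟩

/-! #### The game of a program -/

variable (p)

/-- The locations of Achilles: all but the instructions `ask`. -/
noncomputable def achilles : List (ℕ × Loc) :=
  open Classical in ((locs n Q).filter fun l => (automaton p).IsLoc 0 l ∧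
    ∀ q w j k, l = .node (code q) → p q ≠ .ask w j k).map fun l => (0, l)

/-- The final locations: the instructions `halt`. -/
noncomputable def final : List (ℕ × Loc) :=
  ((locs n Q).filter fun l =>
    @decide (∃ q : Q, l = .node (code q) ∧ p q = .halt) (Classical.dec _)).map fun l => (0, l)

theorem isLoc_of_mem_achilles : ∀ l ∈ achilles p, (automaton p).IsLoc l.1 l.2 := by
  intro l hl
  simp only [achilles, List.mem_map, List.mem_filter, decide_eq_true_eq] at hl
  obtain ⟨l, ⟨-, h, -⟩, rfl⟩ := hl
  exact h

theorem isLoc_of_mem_final : ∀ l ∈ final p, (automaton p).IsLoc l.1 l.2 := by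
  intro l hl
  simp only [final, List.mem_map, List.mem_filter, decide_eq_true_eq] at hl
  obtain ⟨l, ⟨-, q, rfl, -⟩, rfl⟩ := hl
  exact ⟨by simp, code_lt q⟩

variable {p}

theorem cfg_mem_final : cfg κ q ν ∈ Instance.atLoc (final p) ↔ p q = .halt := by
  simp only [Instance.atLoc, cfg, final, List.mem_map, List.mem_filter, decide_eq_true_eq,
    Set.mem_ofPred_eq, Prod.mk.injEq, true_and, exists_eq_right, code_mem_locs, Loc.node.injEq]
  constructor
  · rintro ⟨r, hr, h⟩
    rwa [code_injective hr]
  · exact fun h => ⟨q, rfl, h⟩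

theorem cfg_mem_achilles : cfg κ q ν ∈ Instance.atLoc (achilles p) ↔ ∀ w j k, p q ≠ .ask w j k := by
  simp only [Instance.atLoc, cfg, achilles, List.mem_map, List.mem_filter, decide_eq_true_eq,
    Set.mem_ofPred_eq, Prod.mk.injEq, true_and, exists_eq_right, code_mem_locs, Loc.node.injEq]
  constructor
  · exact fun h w j k => h.2 q w j k rfl
  · refine fun h => ⟨⟨by simp, code_lt q⟩, fun r w j k hr => ?_⟩
    rw [← code_injective hr]
    exact h w j k

theorem call_mem_achilles (hj : ∀ k, p j ≠ .pop k) :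
    (⟨κ, 0, .call v (code j), ν⟩ : Config n) ∈ Instance.atLoc (achilles p) := by
  simp only [Instance.atLoc, achilles, List.mem_map, List.mem_filter, decide_eq_true_eq,
    Set.mem_ofPred_eq, Prod.mk.injEq, true_and, exists_eq_right, call_mem_locs, reduceCtorEq]
  refine ⟨⟨v.2, code_lt j⟩, ⟨by simp, by simp, ?_⟩, by simp⟩
  simpa [code_mem_entries] using hj

theorem call_notMem_final :
    (⟨κ, 0, .call v (code j), ν⟩ : Config n) ∉ Instance.atLoc (final p) := by
  simp [Instance.atLoc, final]

theorem ret_mem_achilles (hq : p q = .pop k) :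
    (⟨κ, 0, .ret v (code q), ν⟩ : Config n) ∈ Instance.atLoc (achilles p) := by
  simp only [Instance.atLoc, achilles, List.mem_map, List.mem_filter, decide_eq_true_eq,
    Set.mem_ofPred_eq, Prod.mk.injEq, true_and, exists_eq_right, ret_mem_locs, reduceCtorEq]
  refine ⟨⟨v.2, code_lt q⟩, ⟨by simp, by simp, ?_⟩, by simp⟩
  simp only [comp_automaton, target_component, code_mem_exits]
  exact ⟨k, hq⟩

theorem ret_notMem_final :
    (⟨κ, 0, .ret v (code q), ν⟩ : Config n) ∉ Instance.atLoc (final p) := by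
  simp [Instance.atLoc, final]

end Ins

end RHA

/-! ### Unfolding one round of forcing -/

namespace LTS

variable {S A : Type} {L : LTS S A} {P F : Set S} {A₀ : Finset A} {cost : A → ℝ≥0}

theorem Forces.exists_of_mem {m : ℕ} {s : S} (h : L.Forces P F A₀ m s) (hF : s ∉ F) (hP : s ∈ P) :
    ∃ m' < m, ∃ a s', L.trans s a = some s' ∧ L.Forces P F A₀ m' s' := by
  cases m with
  | zero => exact absurd h hF
  | succ m =>
    obtain h | ⟨-, h⟩ | ⟨h, -⟩ := h
    · exact absurd h hF
    · exact ⟨m, m.lt_succ_self, h⟩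
    · exact absurd hP h

theorem Forces.forall_of_notMem {m : ℕ} {s : S} (h : L.Forces P F A₀ m s) (hF : s ∉ F)
    (hP : s ∉ P) :
    ∃ m' < m, ∀ a ∈ A₀, ∀ s', L.trans s a = some s' → L.Forces P F A₀ m' s' := by
  cases m with
  | zero => exact absurd h hF
  | succ m =>
    obtain h | ⟨h, -⟩ | ⟨-, h⟩ := h
    · exact absurd h hF
    · exact absurd h hP
    · exact ⟨m, m.lt_succ_self, h⟩

end LTS

/-! ### Forcing rules for the elementary instructions -/

namespace RHA

namespace Ins

variable {n : ℕ} {Q : Type} [Fintype Q] {p : Q → Ins n Q} {κ : List ((ℕ × ℕ) × (Fin n → ℝ))}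
  {ν ν₀ : Fin n → ℝ} {q j k : Q} {v w : Fin n} {S : List (Fin n)} {G : Rect n} {m : ℕ} {c : ℝ≥0}

/-- Achilles can force a visit to a final location within `m` steps, against immediate moves of
Tortoise. -/
def Force (p : Q → Ins n Q) (m : ℕ) (s : Config n) : Prop :=
  (automaton p).lts.Forces (Instance.atLoc (achilles p)) (Instance.atLoc (final p))
    {(0, 0, 0), (0, 0, 1)} m s

/-- Achilles can force a visit to a final location within time `c`. -/
def Within (p : Q → Ins n Q) (c : ℝ≥0) (s : Config n) : Prop :=
  ∃ m, (automaton p).lts.ForcesWithin (Instance.atLoc (achilles p)) (Instance.atLoc (final p))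
    Prod.fst m c s

theorem Force.reset (h : p q = .reset v j) (hs : Force p m (cfg κ q ν)) :
    ∃ m' < m, Force p m' (cfg κ j (Function.update ν v 0)) := by
  obtain ⟨m', hm, e, s', ht, hs'⟩ := hs.exists_of_mem (by simp [cfg_mem_final, h])
    (by simp [cfg_mem_achilles, h])
  rw [trans_reset h] at ht
  exact ⟨m', hm, ht.2.1 ▸ hs'⟩

theorem Force.run (h : p q = .run S G j) (hs : Force p m (cfg κ q ν)) :
    ∃ m' < m, ∃ t, advance ν S t ∈ sat G ∧ Force p m' (cfg κ j (advance ν S t)) := by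
  obtain ⟨m', hm, e, s', ht, hs'⟩ := hs.exists_of_mem (by simp [cfg_mem_final, h])
    (by simp [cfg_mem_achilles, h])
  rw [trans_run h] at ht
  exact ⟨m', hm, e.1, ht.2.1, ht.2.2.1 ▸ hs'⟩

theorem Force.fork (h : p q = .fork j k) (hs : Force p m (cfg κ q ν)) :
    ∃ m' < m, Force p m' (cfg κ j ν) ∨ Force p m' (cfg κ k ν) := by
  obtain ⟨m', hm, e, s', ht, hs'⟩ := hs.exists_of_mem (by simp [cfg_mem_final, h])
    (by simp [cfg_mem_achilles, h])
  rw [trans_fork h] at ht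
  obtain ⟨-, ht, -⟩ | ⟨-, ht, -⟩ := ht
  · exact ⟨m', hm, .inl (ht ▸ hs')⟩
  · exact ⟨m', hm, .inr (ht ▸ hs')⟩

/-- The invariants of both targets are needed because a move that is unavailable to Tortoise yields
no information. -/
theorem Force.ask (h : p q = .ask w j k) (hw : ν w = 0) (hj : Ok p j ν) (hk : Ok p k ν)
    (hs : Force p m (cfg κ q ν)) :
    ∃ m' < m, Force p m' (cfg κ j ν) ∧ Force p m' (cfg κ k ν) := by
  obtain ⟨m', hm, hs'⟩ := hs.forall_of_notMem (by simp [cfg_mem_final, h])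
    (by simp [cfg_mem_achilles, h])
  exact ⟨m', hm, hs' (0, 0, 0) (by simp) _ ((trans_ask h hw).2 ⟨rfl, .inl ⟨rfl, rfl, hj⟩⟩),
    hs' (0, 0, 1) (by simp) _ ((trans_ask h hw).2 ⟨rfl, .inr ⟨rfl, rfl, hk⟩⟩)⟩

theorem Force.push (h : p q = .push v j) (hj : ∀ k, p j ≠ .pop k) (hs : Force p m (cfg κ q ν)) :
    ∃ m' < m, Force p m' (cfg (((0, v.val), ν) :: κ) j ν) := by
  obtain ⟨m', hm, e, s', ht, hs'⟩ := hs.exists_of_mem (by simp [cfg_mem_final, h])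
    (by simp [cfg_mem_achilles, h])
  rw [trans_push h] at ht
  rw [ht.2] at hs'
  obtain ⟨m'', hm', e, s', ht, hs''⟩ := hs'.exists_of_mem call_notMem_final (call_mem_achilles hj)
  rw [trans_call] at ht
  exact ⟨m'', hm'.trans hm, ht.2.1 ▸ hs''⟩

theorem Force.pop (h : p q = .pop k) (hs : Force p m (cfg (((0, v.val), ν₀) :: κ) q ν)) :
    ∃ m' < m, Force p m' (cfg κ k (Function.update ν v (ν₀ v))) := by
  obtain ⟨m', hm, e, s', ht, hs'⟩ := hs.exists_of_mem (by simp [cfg_mem_final, h])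
    (by simp [cfg_mem_achilles, h])
  rw [trans_pop h] at ht
  rw [ht.2] at hs'
  obtain ⟨m'', hm', e, s', ht, hs''⟩ := hs'.exists_of_mem ret_notMem_final (ret_mem_achilles h)
  rw [trans_ret h] at ht
  exact ⟨m'', hm'.trans hm, ht.2.1 ▸ hs''⟩

theorem Within.mono {d : ℝ≥0} {s : Config n} (hcd : c ≤ d) (h : Within p c s) : Within p d s :=
  h.imp fun _ h => h.mono_cost hcd

theorem Within.step {s s' : Config n} {e : TimedAction}
    (hs : s ∈ Instance.atLoc (achilles p)) (ht : (automaton p).lts.trans s e = some s')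
    (h : Within p c s') : Within p (e.1 + c) s := by
  obtain ⟨m, hm⟩ := h
  exact ⟨m + 1, .inr (.inl ⟨hs, e, s', c, ht, le_rfl, hm⟩)⟩

theorem Within.halt (h : p q = .halt) : Within p c (cfg κ q ν) :=
  ⟨0, cfg_mem_final.2 h⟩

theorem Within.reset (h : p q = .reset v j) (hj : Ok p j (Function.update ν v 0))
    (hs : Within p c (cfg κ j (Function.update ν v 0))) : Within p c (cfg κ q ν) := by
  have := hs.step (cfg_mem_achilles.2 (by simp [h])) ((trans_reset h (ν := ν) (κ := κ)
    (e := (0, 0, v.val + 2))).2 ⟨rfl, rfl, hj⟩)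
  simpa using this

theorem Within.run (h : p q = .run S G j) (t : ℝ≥0) (hG : advance ν S t ∈ sat G)
    (hj : Ok p j (advance ν S t)) (hs : Within p c (cfg κ j (advance ν S t))) :
    Within p (t + c) (cfg κ q ν) :=
  hs.step (cfg_mem_achilles.2 (by simp [h])) ((trans_run h (ν := ν) (κ := κ)
    (e := (t, 0, 0))).2 ⟨rfl, hG, rfl, hj⟩)

theorem Within.fork_left (h : p q = .fork j k) (hj : Ok p j ν) (hs : Within p c (cfg κ j ν)) :
    Within p c (cfg κ q ν) := by
  have := hs.step (cfg_mem_achilles.2 (by simp [h])) ((trans_fork h (ν := ν) (κ := κ)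
    (e := (0, 0, 0))).2 (.inl ⟨rfl, rfl, hj⟩))
  simpa using this

theorem Within.fork_right (h : p q = .fork j k) (hk : Ok p k ν) (hs : Within p c (cfg κ k ν)) :
    Within p c (cfg κ q ν) := by
  have := hs.step (cfg_mem_achilles.2 (by simp [h])) ((trans_fork h (ν := ν) (κ := κ)
    (e := (0, 0, 1))).2 (.inr ⟨rfl, rfl, hk⟩))
  simpa using this

theorem Within.ask (h : p q = .ask w j k) (hw : ν w = 0) (hj : Ok p j ν)
    (hsj : Within p c (cfg κ j ν)) (hsk : Within p c (cfg κ k ν)) : Within p c (cfg κ q ν) := by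
  obtain ⟨m₁, h₁⟩ := hsj
  obtain ⟨m₂, h₂⟩ := hsk
  refine ⟨max m₁ m₂ + 1, .inr (.inr ⟨by simp [cfg_mem_achilles, h],
    ⟨(0, 0, 0), _, (trans_ask h hw).2 ⟨rfl, .inl ⟨rfl, rfl, hj⟩⟩⟩, fun e s' ht => ?_⟩)⟩
  rw [trans_ask h hw] at ht
  obtain ⟨he, ⟨-, rfl, -⟩ | ⟨-, rfl, -⟩⟩ := ht
  · exact ⟨c, by simp [he], h₁.mono (le_max_left _ _)⟩
  · exact ⟨c, by simp [he], h₂.mono (le_max_right _ _)⟩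

theorem Within.push (h : p q = .push v j) (hj : ∀ k, p j ≠ .pop k) (hok : Ok p j ν)
    (hs : Within p c (cfg (((0, v.val), ν) :: κ) j ν)) : Within p c (cfg κ q ν) := by
  have h₁ := hs.step (call_mem_achilles (v := v) hj) ((trans_call (κ := κ) (ν := ν)
    (e := (0, 0, 0))).2 ⟨by simp, rfl, hok⟩)
  have h₂ := h₁.step (cfg_mem_achilles.2 (by simp [h])) ((trans_push h (ν := ν) (κ := κ)
    (e := (0, 0, 0))).2 ⟨rfl, rfl⟩)
  simpa using h₂

theorem Within.pop (h : p q = .pop k) (hk : Ok p k (Function.update ν v (ν₀ v)))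
    (hs : Within p c (cfg κ k (Function.update ν v (ν₀ v)))) :
    Within p c (cfg (((0, v.val), ν₀) :: κ) q ν) := by
  have h₁ := hs.step (ret_mem_achilles (v := v) h) ((trans_ret h (κ := κ)
    (e := (0, 0, 0))).2 ⟨rfl, rfl, hk⟩)
  have h₂ := h₁.step (cfg_mem_achilles.2 (by simp [h])) ((trans_pop h (ν := ν) (κ := κ)
    (e := (0, 0, 0))).2 ⟨by simp, rfl⟩)
  simpa using h₂

end Ins

/-! ### Programs with checks and verified guesses -/

/-- Instructions that a program with state set `S` implements by several elementary ones. -/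
inductive Cmd (n : ℕ) (S : Type)
  /-- Achilles chooses a new value of `v` -/
  | guess (v : Fin n) (j : S)
  /-- Tortoise chooses the next state -/
  | both (j k : S)
  /-- Achilles chooses the next state -/
  | either (j k : S)
  /-- Achilles wins if the variables have the same value -/
  | eq (w v : Fin n)
  /-- Achilles wins if `w = v₁ + v₂` -/
  | sum (w v₁ v₂ : Fin n)
  /-- Achilles wins if the variables are `0` -/
  | zero (w v : Fin n)
  /-- put the value of `v` on the stack -/
  | save (v : Fin n) (j : S)
  /-- restore the value on top of the stack -/
  | load (j : S)

namespace Cmd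

open Ins

variable {n : ℕ} {S : Type}

/-- The elementary instructions; `z` is an auxiliary variable, whose value is preserved. -/
def expand (z : Fin n) (f : S → Cmd n S) : S × Fin 6 → Ins n (S × Fin 6)
  | (s, i) => match f s, i with
    | .guess v _, 0 => .reset v (s, 1)
    | .guess v j, 1 => .run [v] [] (j, 0)
    | .both _ _, 0 => .push z (s, 1)
    | .both _ _, 1 => .reset z (s, 2)
    | .both _ _, 2 => .ask z (s, 3) (s, 4)
    | .both j _, 3 => .pop (j, 0)
    | .both _ k, 4 => .pop (k, 0)
    | .either j k, 0 => .fork (j, 0) (k, 0)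
    | .eq w v, 0 => .run [w, v] [⟨w, .eq, 1⟩, ⟨v, .eq, 1⟩] (s, 1)
    | .sum _ v₁ _, 0 => .push v₁ (s, 1)
    | .sum w v₁ _, 1 => .run [v₁, w] [⟨v₁, .eq, 1⟩] (s, 2)
    | .sum _ _ _, 2 => .pop (s, 3)
    | .sum w _ v₂, 3 => .run [v₂, w] [⟨v₂, .eq, 1⟩] (s, 4)
    | .sum w _ _, 4 => .run [] [⟨w, .eq, 2⟩] (s, 5)
    | .zero w v, 0 => .run [] [⟨w, .eq, 0⟩, ⟨v, .eq, 0⟩] (s, 1)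
    | .save v j, 0 => .push v (j, 0)
    | .load j, 0 => .pop (j, 0)
    -- The default value is also the goal: a successful `eq` or `zero` ends in substate `1`, a
    -- successful `sum` in substate `5`.
    | _, _ => .halt

variable {z : Fin n} {f : S → Cmd n S}

/-- Apart from `save`, commands call only their own substates, which are not returns at the place of
entry. Only a `save` directly followed by a `load` would make an exit node an entry. -/
theorem callable_expand (hf : ∀ s v j, f s = .save v j → ∀ k, f j ≠ .load k) :
    Callable (expand z f) := by
  rintro ⟨s, i⟩ v ⟨j, i'⟩ h ⟨k, i''⟩ hk
  cases hs : f s <;> fin_cases i <;> simp [expand, hs] at h <;>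
    obtain ⟨rfl, rfl, rfl⟩ := h
  · simp [expand, hs] at hk
  · simp [expand, hs] at hk
  · rename_i v j
    have := hf _ _ _ hs
    cases hj : f j <;> simp [expand, hj] at hk
    exact this _ hj

/-- Invariants occur only at `ask`, in substate `2`, so the start of a command can always be
entered. -/
theorem ok_zero (j : S) (ν : Fin n → ℝ) : Ok (expand z f) (j, 0) ν := by
  intro w a b h
  cases hj : f j <;> simp [expand, hj] at h

variable [Fintype S] {κ : List ((ℕ × ℕ) × (Fin n → ℝ))} {ν ν₀ : Fin n → ℝ} {s j k : S}
  {v w v₁ v₂ : Fin n} {m : ℕ} {c : ℝ≥0}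

/-- Achilles can force a visit to a final location from the state `s` within `m` steps. -/
def Force (z : Fin n) (f : S → Cmd n S) (m : ℕ) (κ : List ((ℕ × ℕ) × (Fin n → ℝ))) (s : S)
    (ν : Fin n → ℝ) : Prop :=
  Ins.Force (expand z f) m (cfg κ (s, (0 : Fin 6)) ν)

/-- Achilles can force a visit to a final location from the state `s` within time `c`. -/
def Within (z : Fin n) (f : S → Cmd n S) (c : ℝ≥0) (κ : List ((ℕ × ℕ) × (Fin n → ℝ))) (s : S)
    (ν : Fin n → ℝ) : Prop :=
  Ins.Within (expand z f) c (cfg κ (s, (0 : Fin 6)) ν)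

theorem advance_update_self (ν : Fin n → ℝ) (v : Fin n) (t : ℝ≥0) :
    advance (Function.update ν v 0) [v] t = Function.update ν v t := by
  ext x
  by_cases hx : x = v
  · subst hx; simp [advance]
  · simp [advance, hx]

theorem Force.guess (h : f s = .guess v j) (hs : Force z f m κ s ν) :
    ∃ m' < m, ∃ t : ℝ≥0, Force z f m' κ j (Function.update ν v t) := by
  have h₀ : expand z f (s, 0) = .reset v (s, 1) := by simp [expand, h]
  have h₁ : expand z f (s, 1) = .run [v] [] (j, 0) := by simp [expand, h]
  obtain ⟨m₁, hm₁, hs⟩ := Ins.Force.reset h₀ hs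
  obtain ⟨m₂, hm₂, t, -, hs⟩ := Ins.Force.run h₁ hs
  rw [advance_update_self] at hs
  exact ⟨m₂, hm₂.trans hm₁, t, hs⟩

/-- The stopwatch `z` may be reset for the urgent choice since its value is on the stack, and both
exits restore it before the next command. -/
theorem Force.both (h : f s = .both j k) (hs : Force z f m κ s ν) :
    ∃ m' < m, Force z f m' κ j ν ∧ Force z f m' κ k ν := by
  have h₀ : expand z f (s, 0) = .push z (s, 1) := by simp [expand, h]
  have h₁ : expand z f (s, 1) = .reset z (s, 2) := by simp [expand, h]
  have h₂ : expand z f (s, 2) = .ask z (s, 3) (s, 4) := by simp [expand, h]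
  have h₃ : expand z f (s, 3) = .pop (j, 0) := by simp [expand, h]
  have h₄ : expand z f (s, 4) = .pop (k, 0) := by simp [expand, h]
  obtain ⟨m₁, hm₁, hs⟩ := Ins.Force.push h₀ (by simp [h₁]) hs
  obtain ⟨m₂, hm₂, hs⟩ := Ins.Force.reset h₁ hs
  obtain ⟨m₃, hm₃, hs₁, hs₂⟩ := Ins.Force.ask h₂ (by simp) (by simp [Ok, h₃]) (by simp [Ok, h₄]) hs
  obtain ⟨m₄, hm₄, hs₁⟩ := Ins.Force.pop h₃ hs₁
  obtain ⟨m₅, hm₅, hs₂⟩ := Ins.Force.pop h₄ hs₂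
  simp only [Function.update_idem, Function.update_eq_self] at hs₁ hs₂
  exact ⟨max m₄ m₅, by omega, hs₁.mono (le_max_left _ _), hs₂.mono (le_max_right _ _)⟩

theorem Force.either (h : f s = .either j k) (hs : Force z f m κ s ν) :
    ∃ m' < m, Force z f m' κ j ν ∨ Force z f m' κ k ν :=
  Ins.Force.fork (j := (j, 0)) (k := (k, 0)) (by simp [expand, h]) hs

/-- Both stopwatches run for the same time and arrive at `1`. -/
theorem Force.eq (h : f s = .eq w v) (hs : Force z f m κ s ν) : ν w = ν v := by
  have h₀ : expand z f (s, 0) = .run [w, v] [⟨w, .eq, 1⟩, ⟨v, .eq, 1⟩] (s, 1) := by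
    simp [expand, h]
  obtain ⟨_, _, t, ht, -⟩ := Ins.Force.run h₀ hs
  simp [sat, Rel.Holds, advance] at ht
  linarith

theorem Force.zero (h : f s = .zero w v) (hs : Force z f m κ s ν) : ν w = 0 ∧ ν v = 0 := by
  have h₀ : expand z f (s, 0) = .run [] [⟨w, .eq, 0⟩, ⟨v, .eq, 0⟩] (s, 1) := by
    simp [expand, h]
  obtain ⟨_, _, t, ht, -⟩ := Ins.Force.run h₀ hs
  simpa [sat, Rel.Holds, advance] using ht

theorem update_advance (hw : w ≠ v) (t : ℝ≥0) :
    Function.update (advance ν [v, w] t) v (ν v) = advance ν [w] t := by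
  ext x
  by_cases hx : x = v
  · subst hx; simp [advance, hw.symm]
  · simp [advance, hx]

/-- The two runs add `1 - v₁` and `1 - v₂` to `w`, which is passed by reference, so the last guard
`w = 2` says that `w` was the sum. As the return restores `v₁`, the case `v₁ = v₂` is allowed; it is
used to check halves. -/
theorem Force.sum (h : f s = .sum w v₁ v₂) (h₁ : w ≠ v₁) (h₂ : w ≠ v₂)
    (hs : Force z f m κ s ν) : ν w = ν v₁ + ν v₂ := by
  have e₀ : expand z f (s, 0) = .push v₁ (s, 1) := by simp [expand, h]
  have e₁ : expand z f (s, 1) = .run [v₁, w] [⟨v₁, .eq, 1⟩] (s, 2) := by simp [expand, h]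
  have e₂ : expand z f (s, 2) = .pop (s, 3) := by simp [expand, h]
  have e₃ : expand z f (s, 3) = .run [v₂, w] [⟨v₂, .eq, 1⟩] (s, 4) := by simp [expand, h]
  have e₄ : expand z f (s, 4) = .run [] [⟨w, .eq, 2⟩] (s, 5) := by simp [expand, h]
  obtain ⟨_, _, hs⟩ := Ins.Force.push e₀ (by simp [e₁]) hs
  obtain ⟨_, _, t₁, ht₁, hs⟩ := Ins.Force.run e₁ hs
  obtain ⟨_, _, hs⟩ := Ins.Force.pop e₂ hs
  obtain ⟨_, _, t₂, ht₂, hs⟩ := Ins.Force.run e₃ hs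
  obtain ⟨_, _, t₃, ht₃, -⟩ := Ins.Force.run e₄ hs
  rw [update_advance h₁] at ht₂ ht₃
  simp [sat, Rel.Holds, advance, h₂.symm] at ht₁ ht₂ ht₃
  linarith

theorem Force.save (h : f s = .save v j) (hj : ∀ k, f j ≠ .load k) (hs : Force z f m κ s ν) :
    ∃ m' < m, Force z f m' (((0, v.val), ν) :: κ) j ν := by
  refine Ins.Force.push (j := (j, 0)) (by simp [expand, h]) (fun k hk => ?_) hs
  cases hfj : f j <;> simp [expand, hfj] at hk
  exact hj _ hfj

theorem Force.load (h : f s = .load j) (hs : Force z f m (((0, v.val), ν₀) :: κ) s ν) :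
    ∃ m' < m, Force z f m' κ j (Function.update ν v (ν₀ v)) :=
  Ins.Force.pop (k := (j, 0)) (by simp [expand, h]) hs

theorem Within.mono {d : ℝ≥0} (hcd : c ≤ d) (h : Within z f c κ s ν) : Within z f d κ s ν :=
  Ins.Within.mono hcd h

theorem Within.guess (h : f s = .guess v j) (t : ℝ≥0)
    (hs : Within z f c κ j (Function.update ν v t)) : Within z f (t + c) κ s ν := by
  have h₀ : expand z f (s, 0) = .reset v (s, 1) := by simp [expand, h]
  have h₁ : expand z f (s, 1) = .run [v] [] (j, 0) := by simp [expand, h]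
  refine Ins.Within.reset h₀ (by simp [Ok, h₁]) (Ins.Within.run h₁ t (by simp [sat_nil]) ?_ ?_)
  · exact ok_zero _ _
  · rwa [advance_update_self]

theorem Within.both (h : f s = .both j k) (hj : Within z f c κ j ν) (hk : Within z f c κ k ν) :
    Within z f c κ s ν := by
  have h₀ : expand z f (s, 0) = .push z (s, 1) := by simp [expand, h]
  have h₁ : expand z f (s, 1) = .reset z (s, 2) := by simp [expand, h]
  have h₂ : expand z f (s, 2) = .ask z (s, 3) (s, 4) := by simp [expand, h]
  have h₃ : expand z f (s, 3) = .pop (j, 0) := by simp [expand, h]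
  have h₄ : expand z f (s, 4) = .pop (k, 0) := by simp [expand, h]
  refine Ins.Within.push h₀ (by simp [h₁]) (by simp [Ok, h₁]) (Ins.Within.reset h₁ ?_
    (Ins.Within.ask h₂ (by simp) (by simp [Ok, h₃]) (Ins.Within.pop h₃ (ok_zero _ _) ?_)
      (Ins.Within.pop h₄ (ok_zero _ _) ?_)))
  · rintro w a b hab
    rw [h₂, Ins.ask.injEq] at hab
    obtain ⟨rfl, -⟩ := hab
    simp
  · rwa [Function.update_idem, Function.update_eq_self]
  · rwa [Function.update_idem, Function.update_eq_self]

theorem Within.either_left (h : f s = .either j k) (hj : Within z f c κ j ν) :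
    Within z f c κ s ν :=
  Ins.Within.fork_left (j := (j, 0)) (k := (k, 0)) (by simp [expand, h]) (ok_zero _ _) hj

theorem Within.either_right (h : f s = .either j k) (hk : Within z f c κ k ν) :
    Within z f c κ s ν :=
  Ins.Within.fork_right (j := (j, 0)) (k := (k, 0)) (by simp [expand, h]) (ok_zero _ _) hk

/-- Stopwatches can only move up to `1`, so checks succeed only on values at most `1`; this is why
values have to be scaled down. -/
theorem Within.eq (h : f s = .eq w v) (hwv : ν w = ν v) (h₀ : 0 ≤ ν v) (h₁ : ν v ≤ 1) :
    Within z f 1 κ s ν := by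
  have e₀ : expand z f (s, 0) = .run [w, v] [⟨w, .eq, 1⟩, ⟨v, .eq, 1⟩] (s, 1) := by
    simp [expand, h]
  have e₁ : expand z f (s, 1) = .halt := by simp [expand, h]
  obtain ⟨t, ht⟩ : ∃ t : ℝ≥0, (t : ℝ) = 1 - ν v := ⟨⟨_, sub_nonneg.2 h₁⟩, rfl⟩
  refine (Ins.Within.run (c := 0) e₀ t ?_ (by simp [Ok, e₁]) (Ins.Within.halt e₁)).mono ?_
  · simp [sat, Rel.Holds, advance, hwv, ht]
  · rw [add_zero, ← NNReal.coe_le_coe, ht, NNReal.coe_one]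
    linarith

theorem Within.zero (h : f s = .zero w v) (hw : ν w = 0) (hv : ν v = 0) :
    Within z f 0 κ s ν := by
  have e₀ : expand z f (s, 0) = .run [] [⟨w, .eq, 0⟩, ⟨v, .eq, 0⟩] (s, 1) := by
    simp [expand, h]
  have e₁ : expand z f (s, 1) = .halt := by simp [expand, h]
  have := Ins.Within.run (c := 0) (κ := κ) (ν := ν) e₀ 0 (by simp [sat, Rel.Holds, hw, hv])
    (by simp [Ok, e₁]) (Ins.Within.halt e₁)
  rwa [add_zero] at this

theorem Within.sum (h : f s = .sum w v₁ v₂) (h₁ : w ≠ v₁) (h₂ : w ≠ v₂)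
    (hw : ν w = ν v₁ + ν v₂) (h₁₀ : 0 ≤ ν v₁) (h₁₁ : ν v₁ ≤ 1) (h₂₀ : 0 ≤ ν v₂)
    (h₂₁ : ν v₂ ≤ 1) : Within z f 2 κ s ν := by
  have e₀ : expand z f (s, 0) = .push v₁ (s, 1) := by simp [expand, h]
  have e₁ : expand z f (s, 1) = .run [v₁, w] [⟨v₁, .eq, 1⟩] (s, 2) := by simp [expand, h]
  have e₂ : expand z f (s, 2) = .pop (s, 3) := by simp [expand, h]
  have e₃ : expand z f (s, 3) = .run [v₂, w] [⟨v₂, .eq, 1⟩] (s, 4) := by simp [expand, h]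
  have e₄ : expand z f (s, 4) = .run [] [⟨w, .eq, 2⟩] (s, 5) := by simp [expand, h]
  have e₅ : expand z f (s, 5) = .halt := by simp [expand, h]
  obtain ⟨t₁, ht₁⟩ : ∃ t : ℝ≥0, (t : ℝ) = 1 - ν v₁ := ⟨⟨_, sub_nonneg.2 h₁₁⟩, rfl⟩
  obtain ⟨t₂, ht₂⟩ : ∃ t : ℝ≥0, (t : ℝ) = 1 - ν v₂ := ⟨⟨_, sub_nonneg.2 h₂₁⟩, rfl⟩
  refine Ins.Within.mono ?_ (Ins.Within.push e₀ (by simp [e₁]) (by simp [Ok, e₁])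
    (Ins.Within.run e₁ t₁ ?_ (by simp [Ok, e₂])
    (Ins.Within.pop e₂ (by simp [Ok, e₃])
    (Ins.Within.run e₃ t₂ ?_ (by simp [Ok, e₄])
    (Ins.Within.run (c := 0) e₄ 0 ?_ (by simp [Ok, e₅]) (Ins.Within.halt e₅))))))
  · rw [← NNReal.coe_le_coe]
    push_cast
    linarith
  · simp [sat, Rel.Holds, advance, ht₁]
  · rw [update_advance h₁]
    simp [sat, Rel.Holds, advance, h₂.symm, ht₂]
  · rw [update_advance h₁]
    simp [sat, Rel.Holds, advance, hw, ht₁, ht₂]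
    ring

theorem Within.save (h : f s = .save v j) (hj : ∀ k, f j ≠ .load k)
    (hs : Within z f c (((0, v.val), ν) :: κ) j ν) : Within z f c κ s ν := by
  refine Ins.Within.push (j := (j, 0)) (by simp [expand, h]) (fun k hk => ?_) (ok_zero _ _) hs
  cases hfj : f j <;> simp [expand, hfj] at hk
  exact hj _ hfj

theorem Within.load (h : f s = .load j) (hs : Within z f c κ j (Function.update ν v (ν₀ v))) :
    Within z f c (((0, v.val), ν₀) :: κ) s ν :=
  Ins.Within.pop (k := (j, 0)) (by simp [expand, h]) (ok_zero _ _) hs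

end Cmd

end RHA

/-! ### Systems of equations between binary relations -/

/-- The right hand sides of a system of equations that defines binary relations, named by `I`. -/
inductive RelEq (I : Type)
  /-- the pair `(0, 0)` -/
  | origin
  /-- all pairs `(a, a + 1)` -/
  | succ
  /-- all pairs `(a, b)` such that, for some `d`, `(d, a)` and `(d, b)` are in given relations -/
  | span (j k : I)
  | inter (j k : I)
  | union (j k : I)

namespace RelEq

variable {I : Type}

/-- The least solution of a system of equations, over the real numbers. -/
inductive Sem (P : I → RelEq I) : I → ℝ → ℝ → Prop
  | origin {i : I} (h : P i = .origin) : Sem P i 0 0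
  | succ {i : I} (h : P i = .succ) (a : ℝ) : Sem P i a (a + 1)
  | span {i j k : I} (h : P i = .span j k) {a b d : ℝ} (hd : 0 ≤ d) (ha : Sem P j d a)
      (hb : Sem P k d b) : Sem P i a b
  | inter {i j k : I} (h : P i = .inter j k) {a b : ℝ} (hj : Sem P j a b) (hk : Sem P k a b) :
      Sem P i a b
  | union_left {i j k : I} (h : P i = .union j k) {a b : ℝ} (hj : Sem P j a b) : Sem P i a b
  | union_right {i j k : I} (h : P i = .union j k) {a b : ℝ} (hk : Sem P k a b) : Sem P i a b

end RelEq

namespace RHA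

/-! ### The game for a system of equations -/

namespace RelGame

open Cmd RelEq

variable {n : ℕ} {I : Type}

/-- In the state `(some i, 0)` with `Y > 0`, Achilles claims that `(X / Y, Z / Y)` is in
the relation `i`; from the state `(none, 0)` he may divide `X` and `Y` by `2` several times,
before he chooses `Z` and claims that `(X / Y, Z / Y)` is in the relation `i₀`. -/
def program (X Y Z : Fin n) (P : I → RelEq I) (i₀ : I) :
    Option I × Fin 14 → Cmd n (Option I × Fin 14)
  | (some i, a) => match P i, a with
    | .origin, _ => .zero X Z
    | .succ, _ => .sum Z X Y
    | .inter j k, _ => .both (some j, 0) (some k, 0)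
    | .union j k, _ => .either (some j, 0) (some k, 0)
    | .span _ _, 0 => .save Y (some i, 1)
    | .span _ _, 1 => .guess Y (some i, 2)
    | .span _ _, 2 => .both (some i, 3) (some i, 9)
    | .span _ _, 3 => .guess Z (some i, 4)
    | .span _ _, 4 => .both (some i, 5) (some i, 8)
    | .span _ _, 5 => .guess X (some i, 6)
    | .span _ _, 6 => .both (some i, 7) (some i, 12)
    | .span j _, 7 => .load (some j, 0)
    | .span _ _, 8 => .eq Z X
    | .span _ _, 9 => .guess X (some i, 10)
    | .span _ _, 10 => .both (some i, 11) (some i, 12)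
    | .span _ k, 11 => .load (some k, 0)
    | .span _ _, _ => .eq X Y
  | (none, a) => match a with
    | 0 => .either (none, 1) (none, 13)
    | 1 => .guess Z (none, 2)
    | 2 => .both (none, 3) (none, 9)
    | 3 => .guess X (none, 4)
    | 4 => .both (none, 5) (none, 10)
    | 5 => .guess Z (none, 6)
    | 6 => .both (none, 7) (none, 11)
    | 7 => .guess Y (none, 8)
    | 8 => .both (none, 0) (none, 12)
    | 9 => .sum X Z Z
    | 10 => .eq X Z
    | 11 => .sum Y Z Z
    | 12 => .eq Y Z
    | 13 => .guess Z (some i₀, 0)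

variable {X Y Z : Fin n} {P : I → RelEq I} {i₀ : I}

theorem save_program : ∀ s v j, program X Y Z P i₀ s = .save v j →
    ∀ k, program X Y Z P i₀ j ≠ .load k := by
  rintro ⟨_ | i, a⟩ v j h k
  · fin_cases a <;> simp [program] at h
  · cases hi : P i <;> fin_cases a <;> simp [program, hi] at h
    obtain ⟨rfl, rfl⟩ := h
    simp [program, hi]

/-! ### Soundness and completeness of the game -/

variable [Fintype I] {κ : List ((ℕ × ℕ) × (Fin n → ℝ))} {ν : Fin n → ℝ} {m : ℕ}

/-- Time plays no role here. Every guess that should be a copy is subject to a check by Tortoise and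
hence exact; only the witness `d` of a `span` is free. The system may be cyclic, so the induction is
on the number of steps, over all stacks. -/
theorem sem_of_force (hXY : X ≠ Y) (hXZ : X ≠ Z) (hYZ : Y ≠ Z) {i : I} (hY : 0 < ν Y)
    (h : Force Z (program X Y Z P i₀) m κ (some i, 0) ν) : Sem P i (ν X / ν Y) (ν Z / ν Y) := by
  induction m using Nat.strong_induction_on generalizing κ i ν with
  | _ m ih =>
    cases hi : P i with
    | origin =>
      obtain ⟨hX, hZ⟩ := h.zero (w := X) (v := Z) (by simp [program, hi])
      rw [hX, hZ, zero_div]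
      exact .origin hi
    | succ =>
      have := h.sum (w := Z) (v₁ := X) (v₂ := Y) (by simp [program, hi]) hXZ.symm hYZ.symm
      rw [this, add_div, div_self hY.ne']
      exact .succ hi _
    | inter j k =>
      obtain ⟨m', hm, h₁, h₂⟩ := h.both (j := (some j, 0)) (k := (some k, 0))
        (by simp [program, hi])
      exact .inter hi (ih m' hm hY h₁) (ih m' hm hY h₂)
    | union j k =>
      obtain ⟨m', hm, h | h⟩ := h.either (j := (some j, 0)) (k := (some k, 0))
        (by simp [program, hi])
      · exact .union_left hi (ih m' hm hY h)
      · exact .union_right hi (ih m' hm hY h)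
    | span j k =>
      -- With `d` in `Y`, the left branch copies `X` to `Z` and then `Y` to `X`; the right branch
      -- keeps `Z` and copies `Y` to `X`. In both, `load` brings the unit back to `Y`.
      obtain ⟨m₁, hm₁, h⟩ := h.save (v := Y) (j := (some i, 1)) (by simp [program, hi])
        (by simp [program, hi])
      obtain ⟨m₂, hm₂, d, h⟩ := h.guess (v := Y) (j := (some i, 2)) (by simp [program, hi])
      obtain ⟨m₃, hm₃, hl, hr⟩ := h.both (j := (some i, 3)) (k := (some i, 9))
        (by simp [program, hi])
      obtain ⟨m₄, hm₄, t₁, hl⟩ := hl.guess (v := Z) (j := (some i, 4)) (by simp [program, hi])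
      obtain ⟨m₅, hm₅, hl, he₁⟩ := hl.both (j := (some i, 5)) (k := (some i, 8))
        (by simp [program, hi])
      replace he₁ := he₁.eq (w := Z) (v := X) (by simp [program, hi])
      obtain ⟨m₆, hm₆, t₂, hl⟩ := hl.guess (v := X) (j := (some i, 6)) (by simp [program, hi])
      obtain ⟨m₇, hm₇, hl, he₂⟩ := hl.both (j := (some i, 7)) (k := (some i, 12))
        (by simp [program, hi])
      replace he₂ := he₂.eq (w := X) (v := Y) (by simp [program, hi])
      obtain ⟨m₈, hm₈, hl⟩ := hl.load (j := (some j, 0)) (by simp [program, hi])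
      obtain ⟨n₄, hn₄, t₃, hr⟩ := hr.guess (v := X) (j := (some i, 10)) (by simp [program, hi])
      obtain ⟨n₅, hn₅, hr, he₃⟩ := hr.both (j := (some i, 11)) (k := (some i, 12))
        (by simp [program, hi])
      replace he₃ := he₃.eq (w := X) (v := Y) (by simp [program, hi])
      obtain ⟨n₆, hn₆, hr⟩ := hr.load (j := (some k, 0)) (by simp [program, hi])
      simp [hXY, hXY.symm, hXZ, hYZ] at he₁ he₂ he₃
      have hl := ih m₈ (by omega) (by simpa using hY) hl
      have hr := ih n₆ (by omega) (by simpa using hY) hr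
      simp [hXY, hXZ.symm, hYZ.symm, he₁, he₂, he₃] at hl hr
      exact .span hi (d := d / ν Y) (by positivity) hl hr

/-- The ratio `X / Y` is invariant: in each round `Z` is checked to be half of `X` and copied to
`X`, and then the same is done with `Y`. -/
theorem exists_sem_of_force (hXY : X ≠ Y) (hXZ : X ≠ Z) (hYZ : Y ≠ Z) (hY : 0 < ν Y)
    (h : Force Z (program X Y Z P i₀) m κ (none, 0) ν) : ∃ b, Sem P i₀ (ν X / ν Y) b := by
  induction m using Nat.strong_induction_on generalizing κ ν with
  | _ m ih =>
    obtain ⟨m₁, hm₁, h | h⟩ := h.either (j := (none, 1)) (k := (none, 13)) (by simp [program])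
    · obtain ⟨m₂, hm₂, t₁, h⟩ := h.guess (v := Z) (j := (none, 2)) (by simp [program])
      obtain ⟨m₃, hm₃, h, e₁⟩ := h.both (j := (none, 3)) (k := (none, 9)) (by simp [program])
      replace e₁ := e₁.sum (w := X) (v₁ := Z) (v₂ := Z) (by simp [program]) hXZ hXZ
      obtain ⟨m₄, hm₄, t₂, h⟩ := h.guess (v := X) (j := (none, 4)) (by simp [program])
      obtain ⟨m₅, hm₅, h, e₂⟩ := h.both (j := (none, 5)) (k := (none, 10)) (by simp [program])
      replace e₂ := e₂.eq (w := X) (v := Z) (by simp [program])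
      obtain ⟨m₆, hm₆, t₃, h⟩ := h.guess (v := Z) (j := (none, 6)) (by simp [program])
      obtain ⟨m₇, hm₇, h, e₃⟩ := h.both (j := (none, 7)) (k := (none, 11)) (by simp [program])
      replace e₃ := e₃.sum (w := Y) (v₁ := Z) (v₂ := Z) (by simp [program]) hYZ hYZ
      obtain ⟨m₈, hm₈, t₄, h⟩ := h.guess (v := Y) (j := (none, 8)) (by simp [program])
      obtain ⟨m₉, hm₉, h, e₄⟩ := h.both (j := (none, 0)) (k := (none, 12)) (by simp [program])
      replace e₄ := e₄.eq (w := Y) (v := Z) (by simp [program])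
      simp [hXY.symm, hXZ, hXZ.symm, hYZ, hYZ.symm] at e₁ e₂ e₃ e₄
      have hY' : (t₄ : ℝ) = ν Y / 2 := by rw [e₃, e₄]; ring
      have hX' : (t₂ : ℝ) = ν X / 2 := by rw [e₁, e₂]; ring
      have := ih m₉ (by omega) (by simp [hY', hY]) h
      simp only [Function.update_self, Function.update_of_ne hXY, Function.update_of_ne hXZ, hX',
        hY', div_div_div_cancel_right₀ (two_ne_zero (α := ℝ))] at this
      exact this
    · obtain ⟨m₂, hm₂, t, h⟩ := h.guess (v := Z) (j := (some i₀, 0)) (by simp [program])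
      have := sem_of_force hXY hXZ hYZ (by simpa [hYZ] using hY) h
      simp only [Function.update_of_ne hXZ, Function.update_of_ne hYZ] at this
      exact ⟨_, this⟩

/-- The constant `K` comes from the derivation alone, before the unit is known. It bounds, in units,
the cost of all guesses on one play and also every value that is checked, so `K * ν Y ≤ 1` lets the
checks succeed. The summand `2` pays for the single check that ends the play. -/
theorem within_of_sem (hXY : X ≠ Y) (hXZ : X ≠ Z) (hYZ : Y ≠ Z) {i : I} {a b : ℝ}
    (h : Sem P i a b) (ha : 0 ≤ a) (hb : 0 ≤ b) :
    ∃ K : ℝ, 0 ≤ K ∧ ∀ κ ν, 0 < ν Y → K * ν Y ≤ 1 → ν X = a * ν Y → ν Z = b * ν Y →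
      ∀ c : ℝ≥0, K * ν Y + 2 ≤ c → Within Z (program X Y Z P i₀) c κ (some i, 0) ν := by
  induction h with
  | origin hi =>
    refine ⟨0, le_rfl, fun κ ν _ _ hX hZ c _ => ?_⟩
    exact (Within.zero (w := X) (v := Z) (by simp [program, hi]) (by simp [hX])
      (by simp [hZ])).mono zero_le
  | succ hi a =>
    refine ⟨a + 1, by positivity, fun κ ν hY hK hX hZ c hc => ?_⟩
    have h₀ : 0 ≤ a * ν Y := by positivity
    refine (Within.sum (w := Z) (v₁ := X) (v₂ := Y) (by simp [program, hi]) hXZ.symm hYZ.symm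
      (by rw [hZ, hX]; ring) (by rw [hX]; exact h₀) (by linarith) hY.le (by linarith)).mono ?_
    rw [← NNReal.coe_le_coe, NNReal.coe_ofNat]
    linarith
  | @inter i j k hi a b _ _ ih₁ ih₂ =>
    obtain ⟨K₁, hK₁, h₁⟩ := ih₁ ha hb
    obtain ⟨K₂, hK₂, h₂⟩ := ih₂ ha hb
    refine ⟨K₁ + K₂, by positivity, fun κ ν hY hK hX hZ c hc => ?_⟩
    have : 0 ≤ K₁ * ν Y := by positivity
    have : 0 ≤ K₂ * ν Y := by positivity
    exact .both (j := (some j, 0)) (k := (some k, 0)) (by simp [program, hi])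
      (h₁ κ ν hY (by linarith) hX hZ c (by linarith))
      (h₂ κ ν hY (by linarith) hX hZ c (by linarith))
  | @union_left i j k hi a b _ ih =>
    obtain ⟨K, hK, h⟩ := ih ha hb
    exact ⟨K, hK, fun κ ν hY hK hX hZ c hc => .either_left (j := (some j, 0)) (k := (some k, 0))
      (by simp [program, hi]) (h κ ν hY hK hX hZ c hc)⟩
  | @union_right i j k hi a b _ ih =>
    obtain ⟨K, hK, h⟩ := ih ha hb
    exact ⟨K, hK, fun κ ν hY hK hX hZ c hc => .either_right (j := (some j, 0)) (k := (some k, 0))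
      (by simp [program, hi]) (h κ ν hY hK hX hZ c hc)⟩
  | @span i j k hi a b d hd _ _ ih₁ ih₂ =>
    obtain ⟨K₁, hK₁, h₁⟩ := ih₁ hd ha
    obtain ⟨K₂, hK₂, h₂⟩ := ih₂ hd hb
    -- The number `d` is guessed in `Y` and again in `X`, and `a` once in `Z`.
    refine ⟨2 * d + a + K₁ + K₂, by positivity, fun κ ν hY hK hX hZ c hc => ?_⟩
    have hk₁ : 0 ≤ K₁ * ν Y := by positivity
    have hk₂ : 0 ≤ K₂ * ν Y := by positivity
    have hd' : 0 ≤ d * ν Y := by positivity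
    have ha' : 0 ≤ a * ν Y := by positivity
    obtain ⟨δ, hδ⟩ : ∃ t : ℝ≥0, (t : ℝ) = d * ν Y := ⟨⟨_, hd'⟩, rfl⟩
    obtain ⟨α, hα⟩ : ∃ t : ℝ≥0, (t : ℝ) = a * ν Y := ⟨⟨_, ha'⟩, rfl⟩
    obtain ⟨C, hC⟩ : ∃ t : ℝ≥0, (t : ℝ) = K₁ * ν Y + K₂ * ν Y + 2 := ⟨⟨_, by positivity⟩, rfl⟩
    have hC₁ : 1 ≤ C := by
      rw [← NNReal.coe_le_coe, NNReal.coe_one]; linarith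
    refine Within.mono (c := δ + (α + (δ + C))) ?_ ?_
    · rw [← NNReal.coe_le_coe]
      push_cast
      linarith
    refine .save (v := Y) (j := (some i, 1)) (by simp [program, hi]) (by simp [program, hi]) ?_
    refine .guess (v := Y) (j := (some i, 2)) (by simp [program, hi]) δ ?_
    refine .both (j := (some i, 3)) (k := (some i, 9)) (by simp [program, hi]) ?_ ?_
    · refine .guess (v := Z) (j := (some i, 4)) (by simp [program, hi]) α ?_
      refine .both (j := (some i, 5)) (k := (some i, 8)) (by simp [program, hi]) ?_ ?_
      · refine .guess (v := X) (j := (some i, 6)) (by simp [program, hi]) δ ?_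
        refine .both (j := (some i, 7)) (k := (some i, 12)) (by simp [program, hi]) ?_ ?_
        · refine .load (j := (some j, 0)) (by simp [program, hi]) ?_
          refine h₁ _ _ ?_ ?_ ?_ ?_ C ?_
          · simpa using hY
          · simp only [Function.update_self]; linarith
          · simp [hXY, hδ]
          · simp [hXZ.symm, hYZ.symm, hα]
          · simp only [Function.update_self]; linarith
        · refine (Within.eq (w := X) (v := Y) (by simp [program, hi]) ?_ ?_ ?_).mono hC₁
          · simp [hXY.symm, hYZ]
          · simp [hXY.symm, hYZ]
          · simp only [Function.update_self, Function.update_of_ne hXY.symm,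
              Function.update_of_ne hYZ, hδ]
            linarith
      · refine (Within.eq (w := Z) (v := X) (by simp [program, hi]) ?_ ?_ ?_).mono
          (le_add_left hC₁)
        · simp [hXY, hXZ, hα, hX]
        · simp [hXY, hXZ, hX, ha']
        · simp only [Function.update_of_ne hXZ, Function.update_of_ne hXY, hX]
          linarith
    -- The right branch does not guess `Z`, so its share `α` of the budget is left over.
    · refine Within.mono (c := δ + C) le_add_self ?_
      refine .guess (v := X) (j := (some i, 10)) (by simp [program, hi]) δ ?_
      refine .both (j := (some i, 11)) (k := (some i, 12)) (by simp [program, hi]) ?_ ?_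
      · refine .load (j := (some k, 0)) (by simp [program, hi]) ?_
        refine h₂ _ _ ?_ ?_ ?_ ?_ C ?_
        · simpa using hY
        · simp only [Function.update_self]; linarith
        · simp [hXY, hδ]
        · simp [hXZ.symm, hYZ.symm, hZ]
        · simp only [Function.update_self]; linarith
      · refine (Within.eq (w := X) (v := Y) (by simp [program, hi]) ?_ ?_ ?_).mono hC₁
        · simp [hXY.symm]
        · simp [hXY.symm]
        · simp only [Function.update_self, Function.update_of_ne hXY.symm, hδ]
          linarith

/-- A round guesses `X / 2` twice and `Y / 2` twice. It costs `X + Y` and leaves `X + Y + 4`,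
exactly the budget for the halved values, so the number of rounds does not matter. After the last
round, `Z = b * Y` costs at most `1`, and `3` suffices for the derivation. -/
theorem within_of_halving (hXY : X ≠ Y) (hXZ : X ≠ Z) (hYZ : Y ≠ Z) {a b K : ℝ}
    (ha : 0 ≤ a) (hb : 0 ≤ b)
    (hK : ∀ κ ν, 0 < ν Y → K * ν Y ≤ 1 → ν X = a * ν Y → ν Z = b * ν Y →
      ∀ c : ℝ≥0, K * ν Y + 2 ≤ c → Within Z (program X Y Z P i₀) c κ (some i₀, 0) ν)
    (N : ℕ) : ∀ ν : Fin n → ℝ, 0 < ν Y → (K + b) * ν Y ≤ 2 ^ N → ν X = a * ν Y → ν X ≤ 1 →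
      ν Y ≤ 1 → ∀ c : ℝ≥0, 2 * (ν X + ν Y) + 4 ≤ c → (0 ≤ K) →
      Within Z (program X Y Z P i₀) c κ (none, 0) ν := by
  induction N with
  | zero =>
    intro ν hY hN hX hX1 hY1 c hc hK0
    have h₀ : 0 ≤ b * ν Y := by positivity
    have h₁ : 0 ≤ K * ν Y := by positivity
    have h₂ : 0 ≤ ν X := by rw [hX]; positivity
    rw [pow_zero] at hN
    obtain ⟨β, hβ⟩ : ∃ t : ℝ≥0, (t : ℝ) = b * ν Y := ⟨⟨_, h₀⟩, rfl⟩
    refine .either_right (j := (none, 1)) (k := (none, 13)) (by simp [program]) ?_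
    refine (Within.guess (v := Z) (j := (some i₀, 0)) (c := 3) (by simp [program]) β ?_).mono ?_
    · refine hK _ _ (by simpa [hYZ] using hY) ?_ ?_ ?_ _ ?_
      · rw [Function.update_of_ne hYZ]; linarith
      · simpa [hXZ, hYZ] using hX
      · simp [hYZ, hβ]
      · rw [Function.update_of_ne hYZ, NNReal.coe_ofNat]; linarith
    · rw [← NNReal.coe_le_coe, NNReal.coe_add, NNReal.coe_ofNat, hβ]
      linarith
  | succ N ih =>
    intro ν hY hN hX hX1 hY1 c hc hK0
    have h₂ : 0 ≤ ν X := by rw [hX]; positivity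
    obtain ⟨x, hx⟩ : ∃ t : ℝ≥0, (t : ℝ) = ν X / 2 := ⟨⟨_, by positivity⟩, rfl⟩
    obtain ⟨y, hy⟩ : ∃ t : ℝ≥0, (t : ℝ) = ν Y / 2 := ⟨⟨_, by positivity⟩, rfl⟩
    obtain ⟨C, hC⟩ : ∃ t : ℝ≥0, (t : ℝ) = ν X + ν Y + 4 := ⟨⟨_, by positivity⟩, rfl⟩
    have hC1 : 1 ≤ C := by
      rw [← NNReal.coe_le_coe, NNReal.coe_one]; linarith
    have hC2 : 2 ≤ C := by
      rw [← NNReal.coe_le_coe, NNReal.coe_ofNat]; linarith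
    refine Within.mono (c := x + (x + (y + (y + C)))) ?_ ?_
    · rw [← NNReal.coe_le_coe]
      push_cast
      linarith
    refine .either_left (j := (none, 1)) (k := (none, 13)) (by simp [program]) ?_
    refine .guess (v := Z) (j := (none, 2)) (by simp [program]) x ?_
    refine .both (j := (none, 3)) (k := (none, 9)) (by simp [program]) ?_ ?_
    · refine .guess (v := X) (j := (none, 4)) (by simp [program]) x ?_
      refine .both (j := (none, 5)) (k := (none, 10)) (by simp [program]) ?_ ?_
      · refine .guess (v := Z) (j := (none, 6)) (by simp [program]) y ?_
        refine .both (j := (none, 7)) (k := (none, 11)) (by simp [program]) ?_ ?_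
        · refine .guess (v := Y) (j := (none, 8)) (by simp [program]) y ?_
          refine .both (j := (none, 0)) (k := (none, 12)) (by simp [program]) ?_ ?_
          · refine ih _ ?_ ?_ ?_ ?_ ?_ C ?_ hK0
            · simp [hy, hY]
            · rw [Function.update_self, hy]
              rw [pow_succ] at hN
              linarith
            · simp [hXY, hXZ, hx, hy, hX]; ring
            · simp [hXY, hXZ, hx]; linarith
            · simp [hy]; linarith
            · simp [hXY, hXZ, hx, hy, hC]; linarith
          · refine (Within.eq (w := Y) (v := Z) (by simp [program]) ?_ ?_ ?_).mono hC1
            · simp [hYZ.symm]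
            · simp [hYZ.symm]
            · simp only [Function.update_self, Function.update_of_ne hYZ.symm, hy]
              linarith
        · refine (Within.sum (w := Y) (v₁ := Z) (v₂ := Z) (by simp [program]) hYZ hYZ ?_ ?_ ?_ ?_ ?_).mono
            (hC2.trans le_add_self)
          · simp [hYZ, hXY.symm, hy]
          · simp
          · simp only [Function.update_self, hy]; linarith
          · simp
          · simp only [Function.update_self, hy]; linarith
      · refine (Within.eq (w := X) (v := Z) (by simp [program]) ?_ ?_ ?_).mono
          (hC1.trans (le_add_self.trans le_add_self))
        · simp [hXZ.symm]
        · simp [hXZ.symm]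
        · simp only [Function.update_self, Function.update_of_ne hXZ.symm, hx]
          linarith
    · refine (Within.sum (w := X) (v₁ := Z) (v₂ := Z) (by simp [program]) hXZ hXZ ?_ ?_ ?_ ?_ ?_).mono
        (hC2.trans (le_add_self.trans (le_add_self.trans le_add_self)))
      · simp [hXZ, hx]
      · simp
      · simp only [Function.update_self, hx]; linarith
      · simp
      · simp only [Function.update_self, hx]; linarith

end RelGame

end RHA

/-! ### Relations on the natural numbers defined by systems of equations -/

namespace RelEq

variable {I J : Type}

def map (e : I → J) : RelEq I → RelEq J
  | .origin => .origin
  | .succ => .succ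
  | .span j k => .span (e j) (e k)
  | .inter j k => .inter (e j) (e k)
  | .union j k => .union (e j) (e k)

theorem map_map {K : Type} (e : I → J) (e' : J → K) (q : RelEq I) :
    (q.map e).map e' = q.map (e' ∘ e) := by
  cases q <;> rfl

/-- The value of a right hand side. -/
def eval (ρ : I → ℝ → ℝ → Prop) : RelEq I → ℝ → ℝ → Prop
  | .origin, a, b => a = 0 ∧ b = 0
  | .succ, a, b => b = a + 1
  | .span j k, a, b => ∃ d, 0 ≤ d ∧ ρ j d a ∧ ρ k d b
  | .inter j k, a, b => ρ j a b ∧ ρ k a b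
  | .union j k, a, b => ρ j a b ∨ ρ k a b

theorem sem_iff_eval {P : I → RelEq I} {i : I} {a b : ℝ} :
    Sem P i a b ↔ eval (Sem P) (P i) a b := by
  constructor
  · rintro (h | ⟨h, a⟩ | ⟨h, hd, ha, hb⟩ | ⟨h, hj, hk⟩ | ⟨h, hj⟩ | ⟨h, hk⟩) <;> rw [h]
    · exact ⟨rfl, rfl⟩
    · rfl
    · exact ⟨_, hd, ha, hb⟩
    · exact ⟨hj, hk⟩
    · exact .inl hj
    · exact .inr hk
  · intro h
    cases hi : P i <;> rw [hi] at h
    · obtain ⟨rfl, rfl⟩ := h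
      exact .origin hi
    · obtain rfl : b = a + 1 := h
      exact .succ hi a
    · obtain ⟨d, hd, ha, hb⟩ := h
      exact .span hi hd ha hb
    · exact .inter hi h.1 h.2
    · exact h.elim (.union_left hi) (.union_right hi)

/-- `Sem P` is the least solution. -/
theorem Sem.le {P : I → RelEq I} {ρ : I → ℝ → ℝ → Prop}
    (hρ : ∀ i a b, eval ρ (P i) a b → ρ i a b) {i : I} {a b : ℝ} (h : Sem P i a b) : ρ i a b := by
  induction h with
  | origin h => exact hρ _ _ _ (h ▸ ⟨rfl, rfl⟩)
  | succ h a => exact hρ _ _ _ (h ▸ rfl)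
  | span h hd _ _ ha hb => exact hρ _ _ _ (h ▸ ⟨_, hd, ha, hb⟩)
  | inter h _ _ hj hk => exact hρ _ _ _ (h ▸ ⟨hj, hk⟩)
  | union_left h _ hj => exact hρ _ _ _ (h ▸ .inl hj)
  | union_right h _ hk => exact hρ _ _ _ (h ▸ .inr hk)

/-- The system `Q` extends the system `P`. -/
def Extends (P : I → RelEq I) (Q : J → RelEq J) (e : I → J) : Prop := ∀ i, Q (e i) = (P i).map e

/-- The equations of old names mention only old names, so a derivation that starts at an old name
never leaves them. -/
theorem Extends.sem_iff {P : I → RelEq I} {Q : J → RelEq J} {e : I → J} (he : Extends P Q e)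
    {i : I} {a b : ℝ} : Sem Q (e i) a b ↔ Sem P i a b := by
  constructor
  · suffices ∀ j, Sem Q j a b → ∀ i, e i = j → Sem P i a b from fun h => this _ h i rfl
    intro j h
    induction h with
    | origin h =>
      rintro i rfl
      rw [he] at h
      cases hi : P i <;> rw [hi] at h <;> cases h
      exact .origin hi
    | succ h a =>
      rintro i rfl
      rw [he] at h
      cases hi : P i <;> rw [hi] at h <;> cases h
      exact .succ hi a
    | span h hd _ _ ha hb =>
      rintro i rfl
      rw [he] at h
      cases hi : P i <;> rw [hi] at h <;> cases h
      exact .span hi hd (ha _ rfl) (hb _ rfl)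
    | inter h _ _ hj hk =>
      rintro i rfl
      rw [he] at h
      cases hi : P i <;> rw [hi] at h <;> cases h
      exact .inter hi (hj _ rfl) (hk _ rfl)
    | union_left h _ hj =>
      rintro i rfl
      rw [he] at h
      cases hi : P i <;> rw [hi] at h <;> cases h
      exact .union_left hi (hj _ rfl)
    | union_right h _ hk =>
      rintro i rfl
      rw [he] at h
      cases hi : P i <;> rw [hi] at h <;> cases h
      exact .union_right hi (hk _ rfl)
  · exact fun h => h.le (ρ := fun i a b => Sem Q (e i) a b) fun i a b hab => by
      rw [sem_iff_eval, he]
      cases hi : P i <;> rw [hi] at hab <;> exact hab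

/-- A relation between natural numbers, as a relation between real numbers. -/
def Cast (R : ℕ → ℕ → Prop) (a b : ℝ) : Prop := ∃ m k : ℕ, a = m ∧ b = k ∧ R m k

theorem cast_natCast {R : ℕ → ℕ → Prop} {m k : ℕ} : Cast R m k ↔ R m k := by
  constructor
  · rintro ⟨m', k', hm, hk, h⟩
    rw [Nat.cast_inj] at hm hk
    rwa [hm, hk]
  · exact fun h => ⟨m, k, rfl, rfl, h⟩

/-- The solution of the system `P` at `i` is `R`. -/
def Realizes (P : I → RelEq I) (i : I) (R : ℕ → ℕ → Prop) : Prop :=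
  ∀ a b, Sem P i a b ↔ Cast R a b

/-- Some extension of the system `P` defines `R`. -/
def DefinableOver (P : I → RelEq I) (R : ℕ → ℕ → Prop) : Prop :=
  ∃ (J : Type) (_ : Fintype J) (Q : J → RelEq J) (e : I → J), Extends P Q e ∧ ∃ j, Realizes Q j R

/-- Every system has an extension that defines `R`. -/
def Definable (R : ℕ → ℕ → Prop) : Prop :=
  ∀ (I : Type) [Fintype I] (P : I → RelEq I), DefinableOver P R

/-! ### Adding equations to a system -/

variable {R S T U : ℕ → ℕ → Prop}

theorem DefinableOver.of_extends {P : I → RelEq I} {Q : J → RelEq J} {e : I → J}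
    (he : Extends P Q e) (h : DefinableOver Q R) : DefinableOver P R := by
  obtain ⟨K, hK, Q', e', he', k, hk⟩ := h
  exact ⟨K, hK, Q', e' ∘ e, fun i => by rw [Function.comp, he', he, map_map], k, hk⟩

theorem Realizes.of_extends {P : I → RelEq I} {Q : J → RelEq J} {e : I → J}
    (he : Extends P Q e) {i : I} (h : Realizes P i R) : Realizes Q (e i) R := fun a b => by
  rw [he.sem_iff, h]

/-- This is the purpose of quantifying over all systems in `Definable`: the second relation is
defined over a system that contains the first, so both become available in one system. -/
theorem Definable.of_forall₂ (hR : Definable R) (hS : Definable S)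
    (h : ∀ (I : Type) [Fintype I] (P : I → RelEq I) (r s : I), Realizes P r R → Realizes P s S →
      DefinableOver P T) : Definable T := by
  intro I _ P
  obtain ⟨I₁, _, P₁, e₁, he₁, r, hr⟩ := hR I P
  obtain ⟨I₂, _, P₂, e₂, he₂, s, hs⟩ := hS I₁ P₁
  exact .of_extends he₁ (.of_extends he₂ (h I₂ P₂ (e₂ r) s (hr.of_extends he₂) hs))

/-- The system `P` together with further equations. -/
def append {K : Type} (P : I → RelEq I) (B : K → RelEq (I ⊕ K)) : I ⊕ K → RelEq (I ⊕ K) :=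
  Sum.elim (fun i => (P i).map .inl) B

theorem extends_append {K : Type} (P : I → RelEq I) (B : K → RelEq (I ⊕ K)) :
    Extends P (append P B) .inl := fun _ => rfl

theorem append_inr {K : Type} {P : I → RelEq I} {B : K → RelEq (I ⊕ K)} {k : K} :
    append P B (.inr k) = B k := rfl

theorem sem_append_inl {K : Type} {P : I → RelEq I} {B : K → RelEq (I ⊕ K)} {i : I} {a b : ℝ} :
    Sem (append P B) (.inl i) a b ↔ Sem P i a b := (extends_append P B).sem_iff

theorem definableOver_of_append {K : Type} [Fintype I] [Fintype K] {P : I → RelEq I}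
    (B : K → RelEq (I ⊕ K)) (k : K) (h : Realizes (append P B) (.inr k) R) : DefinableOver P R :=
  ⟨I ⊕ K, inferInstance, append P B, .inl, extends_append P B, .inr k, h⟩

/-- To bound the solution of an extension, it suffices to consider the new equations. -/
theorem sem_append_le {K : Type} {P : I → RelEq I} {B : K → RelEq (I ⊕ K)}
    (ρ : K → ℝ → ℝ → Prop) (hρ : ∀ k a b, eval (Sum.elim (Sem P) ρ) (B k) a b → ρ k a b) {k : K}
    {a b : ℝ} (h : Sem (append P B) (.inr k) a b) : ρ k a b := by
  refine h.le (ρ := Sum.elim (Sem P) ρ) ?_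
  rintro (i | k) a b h
  · rw [Sum.elim_inl, sem_iff_eval]
    simp only [append, Sum.elim_inl] at h
    cases hi : P i <;> rw [hi] at h <;> exact h
  · exact hρ k a b h

theorem Definable.congr (hR : Definable R) (h : ∀ a b, R a b ↔ S a b) : Definable S := by
  have : R = S := by ext a b; exact h a b
  rwa [← this]

/-- The basic successor accepts all reals, so naturality has to come from leastness: the identity on
the naturals grows from `(0, 0)` by adding `1` to both coordinates. A `span` with the successor
increases one coordinate at a time, and the successor on the naturals appears halfway. -/
theorem definable_core : Definable (fun a b => a = 0 ∧ b = 0) ∧ Definable (fun a b => a = b) ∧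
    Definable (fun a b => b = a + 1) := by
  let B (I : Type) : Fin 5 → RelEq (I ⊕ Fin 5)
    | 0 => .origin
    | 1 => .succ
    | 2 => .union (.inr 0) (.inr 3)
    | 3 => .span (.inr 1) (.inr 4)
    | 4 => .span (.inr 2) (.inr 1)
  -- Index `1` is the successor on all reals, index `4` its restriction to the naturals.
  let ρ : Fin 5 → ℝ → ℝ → Prop
    | 0 => fun a b => a = 0 ∧ b = 0
    | 1 => fun a b => b = a + 1
    | 2 => Cast fun a b => a = b
    | 3 => Cast fun a b => a = b
    | 4 => Cast fun a b => b = a + 1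
  have key : ∀ (I : Type) (P : I → RelEq I) {k : Fin 5} {a b : ℝ},
      Sem (append P (B I)) (.inr k) a b → ρ k a b := by
    intro I P k a b
    refine sem_append_le ρ fun k a b h => ?_
    fin_cases k
    · exact h
    · exact h
    · obtain ⟨rfl, rfl⟩ | h := h
      · exact ⟨0, 0, by simp, by simp, rfl⟩
      · exact h
    · obtain ⟨d, -, h₁, m, k, rfl, rfl, h₂⟩ := h
      exact ⟨m + 1, k, by rw [show a = _ from h₁]; push_cast; rfl, rfl, by omega⟩
    · obtain ⟨d, -, ⟨m, k, rfl, rfl, h₁⟩, h₂⟩ := h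
      exact ⟨k, k + 1, rfl, by rw [show b = _ from h₂]; subst h₁; push_cast; rfl, rfl⟩
  have hid : ∀ (I : Type) (P : I → RelEq I) (m : ℕ), Sem (append P (B I)) (.inr 2) m m := by
    intro I P m
    induction m with
    | zero =>
      rw [Nat.cast_zero]
      exact .union_left (append_inr (k := (2 : Fin 5))) (.origin (append_inr (k := (0 : Fin 5))))
    | succ m ih =>
      rw [Nat.cast_succ]
      have hs := Sem.succ (P := append P (B I)) (append_inr (k := (1 : Fin 5))) m
      exact .union_right (append_inr (k := (2 : Fin 5)))
        (.span (append_inr (k := (3 : Fin 5))) m.cast_nonneg hs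
          (.span (append_inr (k := (4 : Fin 5))) m.cast_nonneg ih hs))
  refine ⟨fun I _ P => definableOver_of_append (B I) 0 fun a b => ?_,
    fun I _ P => definableOver_of_append (B I) 2 fun a b => ?_,
    fun I _ P => definableOver_of_append (B I) 4 fun a b => ?_⟩
  · constructor
    · intro h
      obtain ⟨rfl, rfl⟩ := key I P h
      exact ⟨0, 0, by simp, by simp, rfl, rfl⟩
    · rintro ⟨m, k, rfl, rfl, rfl, rfl⟩
      rw [Nat.cast_zero]
      exact .origin (append_inr (k := (0 : Fin 5)))
  · constructor
    · exact key I P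
    · rintro ⟨m, k, rfl, rfl, rfl⟩
      exact hid I P m
  · constructor
    · exact key I P
    · rintro ⟨m, k, rfl, rfl, rfl⟩
      rw [Nat.cast_succ]
      exact .span (append_inr (k := (4 : Fin 5))) m.cast_nonneg (hid I P m)
        (.succ (append_inr (k := (1 : Fin 5))) m)

theorem definable_origin : Definable fun a b => a = 0 ∧ b = 0 := definable_core.1

theorem definable_id : Definable fun a b => a = b := definable_core.2.1

theorem definable_succ : Definable fun a b => b = a + 1 := definable_core.2.2

/-! ### Closure properties of definable relations -/

theorem Definable.span (hR : Definable R) (hS : Definable S) :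
    Definable fun a b => ∃ d, R d a ∧ S d b := by
  refine hR.of_forall₂ hS fun I _ P r s hr hs =>
    definableOver_of_append (fun _ : Unit => .span (.inl r) (.inl s)) () fun a b => ?_
  rw [sem_iff_eval, append_inr]
  simp only [eval, sem_append_inl, hr _ _, hs _ _]
  constructor
  · rintro ⟨_, -, ⟨d, m, rfl, rfl, h₁⟩, ⟨d', k, hd, rfl, h₂⟩⟩
    rw [Nat.cast_inj] at hd
    exact ⟨m, k, rfl, rfl, d, h₁, hd ▸ h₂⟩
  · rintro ⟨m, k, rfl, rfl, d, h₁, h₂⟩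
    exact ⟨d, d.cast_nonneg, ⟨d, m, rfl, rfl, h₁⟩, ⟨d, k, rfl, rfl, h₂⟩⟩

theorem Definable.inter (hR : Definable R) (hS : Definable S) :
    Definable fun a b => R a b ∧ S a b := by
  refine hR.of_forall₂ hS fun I _ P r s hr hs =>
    definableOver_of_append (fun _ : Unit => .inter (.inl r) (.inl s)) () fun a b => ?_
  rw [sem_iff_eval, append_inr]
  simp only [eval, sem_append_inl, hr _ _, hs _ _]
  constructor
  · rintro ⟨⟨m, k, rfl, rfl, h₁⟩, h₂⟩
    exact ⟨m, k, rfl, rfl, h₁, cast_natCast.1 h₂⟩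
  · rintro ⟨m, k, rfl, rfl, h₁, h₂⟩
    exact ⟨cast_natCast.2 h₁, cast_natCast.2 h₂⟩

theorem Definable.union (hR : Definable R) (hS : Definable S) :
    Definable fun a b => R a b ∨ S a b := by
  refine hR.of_forall₂ hS fun I _ P r s hr hs =>
    definableOver_of_append (fun _ : Unit => .union (.inl r) (.inl s)) () fun a b => ?_
  rw [sem_iff_eval, append_inr]
  simp only [eval, sem_append_inl, hr _ _, hs _ _]
  constructor
  · rintro (⟨m, k, rfl, rfl, h⟩ | ⟨m, k, rfl, rfl, h⟩)
    · exact ⟨m, k, rfl, rfl, .inl h⟩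
    · exact ⟨m, k, rfl, rfl, .inr h⟩
  · rintro ⟨m, k, rfl, rfl, h | h⟩
    · exact .inl (cast_natCast.2 h)
    · exact .inr (cast_natCast.2 h)

/-- In a `span` with the identity, the shared first coordinate becomes the second one. With
converses available, a `span` is a composition. -/
theorem Definable.conv (hR : Definable R) : Definable fun a b => R b a :=
  (hR.span definable_id).congr fun a b => by simp

theorem Definable.comp (hR : Definable R) (hS : Definable S) :
    Definable fun a b => ∃ c, R a c ∧ S c b := hR.conv.span hS

/-- The least relation `X` with `R ∪ S ; X ; T ⊆ X`. -/
inductive Linear (R S T : ℕ → ℕ → Prop) : ℕ → ℕ → Prop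
  | base {a b : ℕ} (h : R a b) : Linear R S T a b
  | step {a b c d : ℕ} (hs : S a c) (h : Linear R S T c d) (ht : T d b) : Linear R S T a b

/-- The only source of recursion in what follows. The unknown relation occurs in its own equation,
so the equations have to be added together. -/
theorem Definable.linear (hR : Definable R) (hS : Definable S) (hT : Definable T) :
    Definable (Linear R S T) := by
  intro I _ P
  obtain ⟨I₁, _, P₁, e₁, he₁, r, hr⟩ := hR I P
  refine .of_extends he₁ ?_
  obtain ⟨I₂, _, P₂, e₂, he₂, s, hs⟩ := hS.conv I₁ P₁
  refine .of_extends he₂ ?_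
  obtain ⟨I₃, _, P₃, e₃, he₃, t, ht⟩ := hT I₂ P₂
  refine .of_extends he₃ ?_
  obtain ⟨I₄, _, P, e₄, he₄, i, hi⟩ := definable_id I₃ P₃
  refine .of_extends he₄ ?_
  replace ht := ht.of_extends he₄
  replace hs := (hs.of_extends he₃).of_extends he₄
  replace hr := ((hr.of_extends he₂).of_extends he₃).of_extends he₄
  generalize e₄ t = t at ht
  generalize e₄ (e₃ s) = s at hs
  generalize e₄ (e₃ (e₂ r)) = r at hr
  -- With `X` at index `0`, index `3` is the converse of `X`, index `2` is `X ; T` and index `1` is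
  -- `S ; X ; T`; here `s` stands for the converse of `S`, and `i` for the identity.
  let B : Fin 4 → RelEq (I₄ ⊕ Fin 4)
    | 0 => .union (.inl r) (.inr 1)
    | 1 => .span (.inl s) (.inr 2)
    | 2 => .span (.inr 3) (.inl t)
    | 3 => .span (.inr 0) (.inl i)
  let ρ : Fin 4 → ℝ → ℝ → Prop
    | 0 => Cast (Linear R S T)
    | 1 => Cast fun a b => ∃ c d, S a c ∧ Linear R S T c d ∧ T d b
    | 2 => Cast fun a b => ∃ d, Linear R S T a d ∧ T d b
    | 3 => Cast fun a b => Linear R S T b a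
  refine definableOver_of_append B 0 fun a b => ⟨sem_append_le ρ fun k a b h => ?_, ?_⟩
  · fin_cases k
    · obtain h | h := h
      · obtain ⟨m, k, rfl, rfl, h'⟩ := (hr _ _).1 h
        exact ⟨m, k, rfl, rfl, .base h'⟩
      · obtain ⟨m, k, rfl, rfl, c, d, h₁, h₂, h₃⟩ := h
        exact ⟨m, k, rfl, rfl, .step h₁ h₂ h₃⟩
    · obtain ⟨d, -, h₁, m, k, rfl, rfl, h₂⟩ := h
      obtain ⟨m', k', h, rfl, h₁⟩ := (hs _ _).1 h₁
      rw [Nat.cast_inj] at h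
      subst h
      obtain ⟨d, h₂, h₃⟩ := h₂
      exact ⟨k', k, rfl, rfl, m, d, h₁, h₂, h₃⟩
    · obtain ⟨d, -, ⟨m, k, rfl, rfl, h₁⟩, h₂⟩ := h
      obtain ⟨m', k', h, rfl, h₂⟩ := (ht _ _).1 h₂
      rw [Nat.cast_inj] at h
      subst h
      exact ⟨k, k', rfl, rfl, m, h₁, h₂⟩
    · obtain ⟨d, -, ⟨m, k, rfl, rfl, h₁⟩, h₂⟩ := h
      obtain ⟨m', k', h, rfl, rfl⟩ := (hi _ _).1 h₂
      rw [Nat.cast_inj] at h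
      subst h
      exact ⟨k, m, rfl, rfl, h₁⟩
  · rintro ⟨m, k, rfl, rfl, h⟩
    have hold : ∀ {j : I₄} {U : ℕ → ℕ → Prop} {a b : ℕ}, Realizes P j U → U a b →
        Sem (append P B) (.inl j) a b := fun hj hab =>
      (extends_append P B).sem_iff.2 ((hj _ _).2 (cast_natCast.2 hab))
    induction h with
    | base h => exact .union_left (append_inr (k := (0 : Fin 4))) (hold hr h)
    | @step a b c d h₁ _ h₃ ih =>
      exact .union_right (append_inr (k := (0 : Fin 4)))
        (.span (append_inr (k := (1 : Fin 4))) c.cast_nonneg (hold hs h₁)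
          (.span (append_inr (k := (2 : Fin 4))) d.cast_nonneg
            (.span (append_inr (k := (3 : Fin 4))) c.cast_nonneg ih (hold hi rfl)) (hold ht h₃)))

end RelEq

/-! ### Graphs of partial recursive functions are definable -/

namespace RelEq

variable {R S T : ℕ → ℕ → Prop}

theorem definable_pred : Definable fun a b => a = b + 1 := definable_succ.conv

theorem definable_zero : Definable fun _ b => b = 0 := by
  refine (definable_origin.linear definable_pred definable_id).congr fun a b => ⟨fun h => ?_, ?_⟩
  · induction h with
    | base h => exact h.2
    | step _ _ ht ih => exact ht ▸ ih
  · rintro rfl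
    induction a with
    | zero => exact .base ⟨rfl, rfl⟩
    | succ a ih => exact .step rfl ih rfl

theorem definable_true : Definable fun _ _ => True :=
  (definable_zero.comp definable_zero.conv).congr fun a b => by simp

theorem definable_lt : Definable fun a b => a < b := by
  refine (definable_succ.linear definable_id definable_succ).congr fun a b => ⟨fun h => ?_, ?_⟩
  · induction h with
    | base h => omega
    | step hs _ ht ih => omega
  · intro h
    induction b with
    | zero => omega
    | succ b ih =>
      obtain h | rfl : a < b ∨ a = b := by omega
      · exact .step rfl (ih h) rfl
      · exact .base rfl

theorem Definable.dom (hR : Definable R) : Definable fun a b => a = b ∧ ∃ c, R a c :=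
  definable_id.inter ((hR.comp definable_true).congr fun a b => by simp)

/-- The elements `a` whose images under `S` and `T` are related by `R`. -/
theorem Definable.test (hR : Definable R) (hS : Definable S) (hT : Definable T) :
    Definable fun a b => a = b ∧ ∃ c d, S a c ∧ T a d ∧ R c d := by
  refine (definable_id.inter ((hS.comp hR).comp hT.conv)).congr fun a b => ?_
  constructor
  · rintro ⟨rfl, d, ⟨c, hc, h⟩, hd⟩
    exact ⟨rfl, c, d, hc, hd, h⟩
  · rintro ⟨rfl, c, d, hc, hd, h⟩
    exact ⟨rfl, d, ⟨c, hc, h⟩, hd⟩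

/-! ### Definability of pairing functions -/

/-- An auxiliary pairing function. -/
def code (x y : ℕ) : ℕ := 2 ^ x * (2 * y + 1)

theorem code_inj {x y x' y' : ℕ} : code x y = code x' y' ↔ x = x' ∧ y = y' := by
  refine ⟨fun h => ?_, by rintro ⟨rfl, rfl⟩; rfl⟩
  have key : ∀ x y x' y', x < x' → code x y ≠ code x' y' := by
    intro x y x' y' hx h
    obtain ⟨k, rfl⟩ := Nat.exists_eq_add_of_lt hx
    simp only [code, pow_add, pow_one, mul_assoc] at h
    have := Nat.eq_of_mul_eq_mul_left (by positivity) h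
    have h2 : 2 * y + 1 = 2 * (2 ^ k * (2 * y' + 1)) := by rw [this]; ring
    omega
  obtain hx | rfl | hx := lt_trichotomy x x'
  · exact absurd h (key _ _ _ _ hx)
  · have := Nat.eq_of_mul_eq_mul_left (by positivity) h
    exact ⟨rfl, by omega⟩
  · exact absurd h.symm (key _ _ _ _ hx)

theorem definable_half : Definable fun a b => a = 2 * b := by
  refine (definable_origin.linear definable_pred
    (definable_succ.comp definable_succ)).conv.congr fun a b => ⟨fun h => ?_, ?_⟩
  · induction h with
    | base h => omega
    | step hs _ ht ih =>
      obtain ⟨c, rfl, rfl⟩ := ht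
      omega
  · rintro rfl
    induction b with
    | zero => exact .base ⟨rfl, rfl⟩
    | succ b ih => exact .step rfl ih ⟨_, rfl, by ring⟩

theorem definable_half_pred : Definable fun a b => a = 2 * b + 1 :=
  (definable_pred.comp definable_half).congr fun a b => by simp

/-- The projections of `code` are linear recursions, which is the reason for this choice: `v` is
halved until it is odd, and each halving adds `1` to the result. -/
theorem definable_fst : Definable fun v x => ∃ y, v = code x y := by
  refine ((definable_half_pred.comp definable_zero).linear definable_half definable_succ).congr
    fun v x => ⟨fun h => ?_, ?_⟩
  · induction h with
    | base h =>
      obtain ⟨c, rfl, rfl⟩ := h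
      exact ⟨c, by simp [code]⟩
    | step hs _ ht ih =>
      obtain ⟨y, rfl⟩ := ih
      subst hs ht
      exact ⟨y, by rw [code, code, pow_succ]; ring⟩
  · rintro ⟨y, rfl⟩
    induction x with
    | zero => exact .base ⟨y, by simp [code], rfl⟩
    | succ x ih => exact .step (by rw [code, code, pow_succ]; ring) ih rfl

theorem definable_snd : Definable fun v y => ∃ x, v = code x y := by
  refine (definable_half_pred.linear definable_half definable_id).congr
    fun v y => ⟨fun h => ?_, ?_⟩
  · induction h with
    | base h => exact ⟨0, by simp [code, h]⟩
    | step hs _ ht ih =>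
      obtain ⟨x, rfl⟩ := ih
      subst hs ht
      exact ⟨x + 1, by rw [code, code, pow_succ]; ring⟩
  · rintro ⟨x, rfl⟩
    induction x with
    | zero => exact .base (by simp [code])
    | succ x ih => exact .step (by rw [code, code, pow_succ]; ring) ih rfl

/-- The successor of a pair in the enumeration `Nat.unpair`. -/
def nextPair (x y : ℕ) : ℕ × ℕ :=
  (if x < y then x + 1 else if y < x then x else 0,
    if x + 1 < y then y else if y = x + 1 then 0 else y + 1)

theorem pair_nextPair (x y : ℕ) :
    Nat.pair (nextPair x y).1 (nextPair x y).2 = Nat.pair x y + 1 := by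
  simp only [nextPair, Nat.pair]
  obtain h | h | h | h : x + 1 < y ∨ y = x + 1 ∨ y < x ∨ x = y := by omega
  · simp [h, show x < y by omega]; ring
  · subst h; simp; ring
  · have h₁ : ¬ x < y := by omega
    have h₂ : ¬ x + 1 < y := by omega
    have h₃ : y ≠ x + 1 := by omega
    have h₄ : ¬ x < y + 1 := by omega
    simp [h, h₁, h₂, h₃, h₄]; ring
  · subst h; simp; ring

theorem unpair_succ (a : ℕ) :
    Nat.unpair (a + 1) = nextPair a.unpair.1 a.unpair.2 := by
  have := pair_nextPair a.unpair.1 a.unpair.2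
  rw [Nat.pair_unpair] at this
  rw [← this, Nat.unpair_pair]

theorem definable_nextPair : Definable fun v w => ∃ x y, v = code x y ∧
    w = code (nextPair x y).1 (nextPair x y).2 := by
  -- Case distinctions are unions of partial identities, one for each condition on the components,
  -- composed with the value in that case.
  have hcmp : ∀ {R : ℕ → ℕ → Prop}, Definable R →
      Definable fun v w => v = w ∧ ∃ x y, v = code x y ∧ R x y := fun hR =>
    (hR.test definable_fst definable_snd).congr fun v w => by
      constructor
      · rintro ⟨rfl, x, y, ⟨y', rfl⟩, ⟨x', h⟩, hxy⟩
        obtain ⟨rfl, rfl⟩ := code_inj.1 h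
        exact ⟨rfl, x, _, rfl, hxy⟩
      · rintro ⟨rfl, x, y, rfl, hxy⟩
        exact ⟨rfl, x, y, ⟨y, rfl⟩, ⟨x, rfl⟩, hxy⟩
  have hA : Definable fun v x' => ∃ x y, v = code x y ∧ x' = (nextPair x y).1 := by
    refine (((hcmp definable_lt).comp (definable_fst.comp definable_succ)).union
      (((hcmp definable_lt.conv).comp definable_fst).union
        ((hcmp definable_id).comp definable_zero))).congr fun v x' => ?_
    constructor
    · rintro (⟨_, ⟨rfl, x, y, rfl, h⟩, _, ⟨_, hc⟩, rfl⟩ |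
        ⟨_, ⟨rfl, x, y, rfl, h⟩, _, hc⟩ | ⟨_, ⟨rfl, x, y, rfl, h⟩, rfl⟩)
      · obtain ⟨rfl, rfl⟩ := code_inj.1 hc
        exact ⟨_, _, rfl, by simp [nextPair, h]⟩
      · obtain ⟨rfl, rfl⟩ := code_inj.1 hc
        exact ⟨_, _, rfl, by simp [nextPair, h, h.not_gt]⟩
      · exact ⟨_, _, rfl, by simp [nextPair, h]⟩
    · rintro ⟨x, y, rfl, rfl⟩
      obtain h | h | h := lt_trichotomy x y
      · exact .inl ⟨_, ⟨rfl, x, y, rfl, h⟩, x, ⟨y, rfl⟩, by simp [nextPair, h]⟩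
      · exact .inr (.inr ⟨_, ⟨rfl, x, y, rfl, h⟩, by simp [nextPair, h]⟩)
      · exact .inr (.inl ⟨_, ⟨rfl, x, y, rfl, h⟩, y, by simp [nextPair, h, h.not_gt]⟩)
  have hB : Definable fun v y' => ∃ x y, v = code x y ∧ y' = (nextPair x y).2 := by
    refine (((hcmp (definable_succ.comp definable_lt)).comp definable_snd).union
      (((hcmp definable_succ).comp definable_zero).union
        ((hcmp (definable_lt.conv.union definable_id)).comp
          (definable_snd.comp definable_succ)))).congr fun v y' => ?_
    constructor
    · rintro (⟨_, ⟨rfl, x, y, rfl, _, rfl, h⟩, _, hc⟩ | ⟨_, ⟨rfl, x, y, rfl, h⟩, rfl⟩ |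
        ⟨_, ⟨rfl, x, y, rfl, h⟩, _, ⟨_, hc⟩, rfl⟩)
      · obtain ⟨rfl, rfl⟩ := code_inj.1 hc
        exact ⟨_, _, rfl, by simp [nextPair, h]⟩
      · exact ⟨_, _, rfl, by simp [nextPair, h]⟩
      · obtain ⟨rfl, rfl⟩ := code_inj.1 hc
        exact ⟨_, _, rfl, by
          simp [nextPair, show ¬ x + 1 < y by omega, show y ≠ x + 1 by omega]⟩
    · rintro ⟨x, y, rfl, rfl⟩
      obtain h | h | h : x + 1 < y ∨ y = x + 1 ∨ (y < x ∨ x = y) := by omega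
      · exact .inl ⟨_, ⟨rfl, x, y, rfl, _, rfl, h⟩, x, by simp [nextPair, h]⟩
      · exact .inr (.inl ⟨_, ⟨rfl, x, y, rfl, h⟩, by simp [nextPair, h]⟩)
      · exact .inr (.inr ⟨_, ⟨rfl, x, y, rfl, h⟩, y, ⟨x, rfl⟩, by
          simp [nextPair, show ¬ x + 1 < y by omega, show y ≠ x + 1 by omega]⟩)
  refine ((hA.comp definable_fst.conv).inter (hB.comp definable_snd.conv)).congr fun v w => ?_
  constructor
  · rintro ⟨⟨_, ⟨x, y, rfl, rfl⟩, b, rfl⟩, ⟨_, ⟨x', y', hc, rfl⟩, a, hc'⟩⟩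
    obtain ⟨rfl, rfl⟩ := code_inj.1 hc
    obtain ⟨rfl, rfl⟩ := code_inj.1 hc'
    exact ⟨x, y, rfl, rfl⟩
  · rintro ⟨x, y, rfl, rfl⟩
    exact ⟨⟨_, ⟨x, y, rfl, rfl⟩, _, rfl⟩, ⟨_, ⟨x, y, rfl, rfl⟩, _, rfl⟩⟩

/-- The pair is found by counting: start with `(0, 0)` and apply `nextPair` as many times as `a`
says. Relations being binary, the current pair has to be a single number, hence `code`. -/
theorem definable_unpair : Definable fun a v => v = code a.unpair.1 a.unpair.2 := by
  have hbase : Definable fun a v => a = 0 ∧ v = code 0 0 := by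
    refine (definable_origin.comp (((definable_zero.comp definable_fst.conv).inter
      (definable_zero.comp definable_snd.conv)))).congr fun a v => ?_
    constructor
    · rintro ⟨_, ⟨rfl, rfl⟩, ⟨_, rfl, y, rfl⟩, ⟨_, rfl, x, h⟩⟩
      obtain ⟨rfl, rfl⟩ := code_inj.1 h
      exact ⟨rfl, rfl⟩
    · rintro ⟨rfl, rfl⟩
      exact ⟨0, ⟨rfl, rfl⟩, ⟨0, rfl, 0, rfl⟩, ⟨0, rfl, 0, rfl⟩⟩
  refine (hbase.linear definable_pred definable_nextPair).congr fun a v => ⟨fun h => ?_, ?_⟩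
  · induction h with
    | base h => obtain ⟨rfl, rfl⟩ := h; simp
    | step hs _ ht ih =>
      obtain ⟨x, y, h, rfl⟩ := ht
      obtain ⟨rfl, rfl⟩ := code_inj.1 (ih.symm.trans h)
      rw [hs, unpair_succ]
  · rintro rfl
    induction a with
    | zero => exact .base ⟨rfl, by simp⟩
    | succ a ih => exact .step rfl ih ⟨_, _, rfl, by rw [unpair_succ]⟩

theorem definable_left : Definable fun a b => a.unpair.1 = b := by
  refine (definable_unpair.comp definable_fst).congr fun a b => ?_
  constructor
  · rintro ⟨_, rfl, y, h⟩
    exact (code_inj.1 h).1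
  · rintro rfl
    exact ⟨_, rfl, _, rfl⟩

theorem definable_right : Definable fun a b => a.unpair.2 = b := by
  refine (definable_unpair.comp definable_snd).congr fun a b => ?_
  constructor
  · rintro ⟨_, rfl, y, h⟩
    exact (code_inj.1 h).2
  · rintro rfl
    exact ⟨_, rfl, _, rfl⟩

theorem Definable.pair (hR : Definable R) (hS : Definable S) :
    Definable fun a v => R a v.unpair.1 ∧ S a v.unpair.2 :=
  ((hR.comp definable_left.conv).inter (hS.comp definable_right.conv)).congr fun a v => by simp

/-- The relation between pairs that have the same first component, and related second
components. -/
theorem Definable.onRight (hR : Definable R) :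
    Definable fun v w => v.unpair.1 = w.unpair.1 ∧ R v.unpair.2 w.unpair.2 :=
  (definable_left.pair (definable_right.comp hR)).congr fun a v => by simp

/-! ### Primitive recursion and unbounded search -/

/-- The graph of a partial function. -/
def Graph (f : ℕ →. ℕ) (a b : ℕ) : Prop := b ∈ f a

/-- In `S ; X ; T` the last relation does not see the argument, so the results carry it along: `v =
(a, n)` is related to `w = (v, r)` where `r` is the value at `v`. -/
theorem definable_prec {f g : ℕ →. ℕ} (hf : Definable (Graph f)) (hg : Definable (Graph g)) :
    Definable (Graph (Nat.unpaired fun a n =>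
      n.rec (f a) fun y IH => do let i ← IH; g (Nat.pair a (Nat.pair y i)))) := by
  let F : ℕ → ℕ → Part ℕ := fun a n =>
    n.rec (f a) fun y IH => do let i ← IH; g (Nat.pair a (Nat.pair y i))
  have hF : ∀ a n r, r ∈ F a (n + 1) ↔ ∃ i ∈ F a n, r ∈ g (Nat.pair a (Nat.pair n i)) :=
    fun a n r => by simp [F]
  have hbase : Definable fun v w => w.unpair.1 = v ∧ v.unpair.2 = 0 ∧
      w.unpair.2 ∈ f v.unpair.1 := by
    refine (((definable_right.comp definable_origin).dom.comp
      (definable_id.pair (definable_left.comp hf)))).congr fun v w => ?_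
    simp [Graph]
    constructor
    · rintro ⟨h₁, h₂, h₃⟩; exact ⟨h₂.symm, h₁, h₃⟩
    · rintro ⟨h₁, h₂, h₃⟩; exact ⟨h₂, h₁.symm, h₃⟩
  -- From `((a, n), i)` to `((a, n + 1), r)` with `r` in `g (a, (n, i))`.
  have hstep : Definable fun w w' => (w.unpair.1.unpair.1 = w'.unpair.1.unpair.1 ∧
      w'.unpair.1.unpair.2 = w.unpair.1.unpair.2 + 1) ∧ w'.unpair.2 ∈
        g (Nat.pair w.unpair.1.unpair.1 (Nat.pair w.unpair.1.unpair.2 w.unpair.2)) := by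
    refine ((definable_left.comp definable_succ.onRight).pair
      (((definable_left.comp definable_left).pair
        ((definable_left.comp definable_right).pair definable_right)).comp hg)).congr
          fun w w' => ?_
    simp only [Graph]
    constructor
    · rintro ⟨⟨_, rfl, h₁, h₂⟩, c, ⟨⟨_, rfl, h₃⟩, ⟨_, rfl, h₄⟩, h₅⟩, h₆⟩
      rw [h₃, h₄, h₅, Nat.pair_unpair, Nat.pair_unpair]
      exact ⟨⟨h₃ ▸ h₁, h₄ ▸ h₂⟩, h₆⟩
    · rintro ⟨⟨h₁, h₂⟩, h₃⟩
      exact ⟨⟨_, rfl, h₁, h₂⟩, _, ⟨⟨_, rfl, by simp⟩, ⟨_, rfl, by simp⟩, by simp⟩, h₃⟩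
  have hrec : Definable fun v w => w.unpair.1 = v ∧ w.unpair.2 ∈ F v.unpair.1 v.unpair.2 := by
    refine (hbase.linear definable_pred.onRight hstep).congr fun v w => ⟨fun h => ?_, ?_⟩
    · induction h with
      | base h => exact ⟨h.1, by rw [h.2.1]; exact h.2.2⟩
      | @step v w v' w' hs _ ht ih =>
        obtain ⟨rfl, ih⟩ := ih
        obtain ⟨⟨h₁, h₂⟩, h₃⟩ := ht
        refine ⟨?_, ?_⟩
        · rw [← Nat.pair_unpair w.unpair.1, ← h₁, h₂, ← hs.1, ← hs.2, Nat.pair_unpair]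
        · rw [hs.2, hF, hs.1]
          exact ⟨_, ih, h₃⟩
    · rintro ⟨rfl, h⟩
      generalize hn : w.unpair.1.unpair.2 = n at h
      induction n generalizing w with
      | zero => exact .base ⟨rfl, hn, h⟩
      | succ n ih =>
        rw [hF] at h
        obtain ⟨i, hi, h⟩ := h
        have := ih (w := Nat.pair (Nat.pair w.unpair.1.unpair.1 n) i)
          (by simp) (by simpa only [Nat.unpair_pair] using hi)
        refine .step ?_ this ?_
        · simp [hn]
        · simp [hn, h]
  refine (hrec.comp definable_right).congr fun a b => ?_
  constructor
  · rintro ⟨w, ⟨rfl, h⟩, rfl⟩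
    exact h
  · intro h
    refine ⟨Nat.pair a b, ⟨by simp, ?_⟩, by simp⟩
    rw [Nat.unpair_pair]
    exact h

/-- The search moves from `(a, k)` to `(a, k + 1)` as long as `f` has a positive value, and ends at
a zero; it is started at `(a, 0)`. -/
theorem definable_rfind {f : ℕ →. ℕ} (hf : Definable (Graph f)) :
    Definable (Graph fun a => Nat.rfind fun n => (fun m => m = 0) <$> f (Nat.pair a n)) := by
  have hzero : Definable fun v w => v = w ∧ 0 ∈ f v :=
    (hf.comp definable_origin).dom.congr fun v w => by simp [Graph]
  have hpos : Definable fun v w => v = w ∧ ∃ k, k + 1 ∈ f v :=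
    (hf.comp definable_pred).dom.congr fun v w => by
      simp only [Graph]
      refine and_congr_right fun _ => ⟨?_, ?_⟩
      · rintro ⟨k, _, h, rfl⟩; exact ⟨k, h⟩
      · rintro ⟨k, h⟩; exact ⟨k, _, h, rfl⟩
  have hsearch : Definable fun v w => v.unpair.1 = w.unpair.1 ∧ 0 ∈ f w ∧
      v.unpair.2 ≤ w.unpair.2 ∧ ∀ j, v.unpair.2 ≤ j → j < w.unpair.2 →
        ∃ k, k + 1 ∈ f (Nat.pair v.unpair.1 j) := by
    refine (hzero.linear (hpos.comp definable_succ.onRight) definable_id).congr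
      fun v w => ⟨fun h => ?_, ?_⟩
    · induction h with
      | base h =>
        obtain ⟨rfl, h⟩ := h
        exact ⟨rfl, h, le_rfl, fun j _ _ => by omega⟩
      | @step v w v' w' hs _ ht ih =>
        obtain ⟨_, ⟨rfl, k, hk⟩, h₁, h₂⟩ := hs
        obtain rfl : w' = w := ht
        obtain ⟨i₁, i₂, i₃, i₄⟩ := ih
        refine ⟨h₁.trans i₁, i₂, by omega, fun j hj hj' => ?_⟩
        obtain rfl | hj : j = v.unpair.2 ∨ v'.unpair.2 ≤ j := by omega
        · exact ⟨k, by rwa [Nat.pair_unpair]⟩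
        · rw [h₁]; exact i₄ j hj hj'
    · rintro ⟨h₁, h₂, h₃, h₄⟩
      obtain ⟨d, hd⟩ := Nat.exists_eq_add_of_le h₃
      induction d generalizing v with
      | zero =>
        refine .base ⟨?_, ?_⟩ <;> rw [← Nat.pair_unpair v, h₁, ← Nat.add_zero v.unpair.2, ← hd,
          Nat.pair_unpair]
        exact h₂
      | succ d ih =>
        refine .step (c := Nat.pair v.unpair.1 (v.unpair.2 + 1)) (d := w) ?_ ?_ rfl
        · obtain ⟨k, hk⟩ := h₄ v.unpair.2 le_rfl (by omega)
          exact ⟨v, ⟨rfl, k, by rwa [Nat.pair_unpair] at hk⟩, by simp⟩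
        · apply ih <;> simp only [Nat.unpair_pair]
          · exact h₁
          · omega
          · exact fun j hj hj' => h₄ j (by omega) hj'
          · omega
  refine ((definable_id.pair definable_zero).comp (hsearch.comp definable_right)).congr
    fun a b => ?_
  refine Iff.trans ?_ Nat.mem_rfind.symm
  constructor
  · rintro ⟨v, ⟨rfl, hv⟩, w, ⟨h₁, h₂, -, h₄⟩, rfl⟩
    rw [hv] at h₄
    refine ⟨?_, fun {m} hm => ?_⟩
    · rw [h₁, Nat.pair_unpair]
      simpa using h₂
    · obtain ⟨k, hk⟩ := h₄ m (Nat.zero_le _) hm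
      simp only [Part.map_eq_map, Part.mem_map_iff]
      exact ⟨_, hk, by simp⟩
  · rintro ⟨h₁, h₂⟩
    refine ⟨Nat.pair a 0, by simp, Nat.pair a b, ⟨by simp, ?_, by simp, fun j _ hj => ?_⟩, by simp⟩
    · simpa using h₁
    · have := h₂ (m := j) (by simpa using hj)
      simp only [Part.map_eq_map, Part.mem_map_iff] at this
      obtain ⟨m, hm, h⟩ := this
      obtain ⟨k, rfl⟩ := Nat.exists_eq_succ_of_ne_zero (n := m) (by simpa using h)
      exact ⟨k, by simpa using hm⟩

/-- Graphs of partial recursive functions are definable by systems of equations. -/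
theorem definable_graph {f : ℕ →. ℕ} (hf : Nat.Partrec f) : Definable (Graph f) := by
  induction hf with
  | zero => exact definable_zero.congr fun a b => by simp [Graph, Pure.pure, PFun.pure]
  | succ => exact definable_succ.congr fun a b => by simp [Graph]
  | left => exact definable_left.congr fun a b => by simp [Graph, eq_comm]
  | right => exact definable_right.congr fun a b => by simp [Graph, eq_comm]
  | @pair f g _ _ hf hg =>
    refine (hf.pair hg).congr fun a b => ?_
    simp only [Graph, Seq.seq, Part.map_eq_map, Part.mem_bind_iff, Part.mem_map_iff]
    constructor
    · rintro ⟨h₁, h₂⟩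
      exact ⟨_, ⟨_, h₁, rfl⟩, _, h₂, by simp⟩
    · rintro ⟨_, ⟨x, hx, rfl⟩, y, hy, rfl⟩
      simpa using ⟨hx, hy⟩
  | @comp f g _ _ hf hg =>
    exact (hg.comp hf).congr fun a b => (Part.mem_bind_iff).symm
  | prec _ _ hf hg => exact definable_prec hf hg
  | rfind _ hf => exact definable_rfind hf

end RelEq

namespace RHA

open Ins Cmd RelEq RelGame

/-! ### The games of a relation that is defined by a system of equations -/

namespace RelGame

variable {n : ℕ} {I : Type} [Fintype I]

/-- The valuation with `X = 1`, `Y = 1 / (m + 1)` and the value `0` of all other variables, as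
fractions. -/
def fractions (X Y : Fin n) (m : ℕ) (x : Fin n) : ℤ × ℕ :=
  if x = X then (1, 1) else if x = Y then (1, m + 1) else (0, 1)

/-- The game in which Achilles claims that `m + 1` is in the domain of the relation `i₀`. -/
noncomputable def game (X Y Z : Fin n) (P : I → RelEq I) (i₀ : I) (m : ℕ) : Instance n where
  automaton := Ins.automaton (expand Z (program X Y Z P i₀))
  achilles := Ins.achilles (expand Z (program X Y Z P i₀))
  initComp := 0
  initNode := code ((((none, 0), 0) : (Option I × Fin 14) × Fin 6))
  initVal := fractions X Y m
  final := Ins.final (expand Z (program X Y Z P i₀))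
  bound := 8

variable {X Y Z : Fin n} {P : I → RelEq I} {i₀ : I} {m : ℕ}

noncomputable def start (X Y : Fin n) (m : ℕ) (x : Fin n) : ℝ :=
  ((fractions X Y m x).1 : ℝ) / ((fractions X Y m x).2 : ℝ)

theorem start_left : start X Y m X = 1 := by simp [start, fractions]

theorem start_right (hXY : X ≠ Y) : start X Y m Y = 1 / (m + 1) := by
  simp [start, fractions, hXY.symm]

theorem init_game : (game X Y Z P i₀ m).init =
    cfg [] (((none, 0), 0) : (Option I × Fin 14) × Fin 6) (start X Y m) := rfl

theorem isRSAGame_game : (game X Y Z P i₀ m).IsRSAGame where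
  wellFormed := wellFormed _ (callable_expand save_program)
  stopwatch := isStopwatch _
  achilles := isLoc_of_mem_achilles _
  final := isLoc_of_mem_final _
  initNode := ⟨by simp [game, Ins.automaton], code_lt _⟩
  initVal x := by
    simp only [game, fractions]
    split_ifs <;> simp
  initInv := by
    rw [init_game]
    exact inInv_cfg.2 (ok_zero _ _)

/-- The initial ratio `X / Y` is `m + 1`. Achilles could guess any real partner for it, but
`Realizes` leaves only natural numbers. -/
theorem achillesWins_game (hXY : X ≠ Y) (hXZ : X ≠ Z) (hYZ : Y ≠ Z) {R : ℕ → ℕ → Prop}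
    (hR : Realizes P i₀ R) : (game X Y Z P i₀ m).AchillesWins ↔ ∃ b, R (m + 1) b := by
  have hY : 0 < start X Y m Y := by rw [start_right hXY]; positivity
  have hX : start X Y m X = (m + 1 : ℕ) * start X Y m Y := by
    rw [start_left, start_right hXY]
    push_cast
    field_simp
  constructor
  · rintro ⟨σ, hσ⟩
    obtain ⟨k, hk⟩ := LTS.exists_forces σ {(0, 0, 0), (0, 0, 1)} _
      fun τ => (hσ τ).imp fun k hk => hk.1
    obtain ⟨b, hb⟩ := exists_sem_of_force (m := k) hXY hXZ hYZ hY hk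
    rw [hX, mul_div_cancel_right₀ _ hY.ne'] at hb
    obtain ⟨a, b, ha, -, h⟩ := (hR _ _).1 hb
    rw [Nat.cast_inj] at ha
    exact ⟨b, ha ▸ h⟩
  · rintro ⟨b, hb⟩
    have hsem : Sem P i₀ (m + 1 : ℕ) b := (hR _ _).2 (cast_natCast.2 hb)
    obtain ⟨K, hK₀, hK⟩ := within_of_sem (i₀ := i₀) hXY hXZ hYZ hsem (by positivity)
      (by positivity)
    obtain ⟨N, hN⟩ := pow_unbounded_of_one_lt ((K + b) * start X Y m Y) one_lt_two
    have hY₁ : start X Y m Y ≤ 1 := by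
      rw [start_right hXY, div_le_one (by positivity)]
      simp
    -- The bound is `8 = 2 * (1 + 1) + 4`, since `X = 1` and `Y ≤ 1` initially.
    obtain ⟨k, hk⟩ := within_of_halving (κ := []) hXY hXZ hYZ (by positivity) (by positivity) hK N
      _ hY hN.le hX start_left.le hY₁ 8 (by rw [start_left]; push_cast; linarith) hK₀
    exact LTS.exists_strategy_of_forcesWithin hk

theorem primrec_fractions : Primrec (fractions X Y) := by
  refine Primrec.fin_curry.2 (Primrec₂.swap (Primrec.fin_curry₁.2 fun x => ?_))
  unfold fractions
  split_ifs
  · exact Primrec.const _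
  · exact (Primrec.const 1).pair Primrec.succ
  · exact Primrec.const _

/-- Only the initial valuation depends on `m`. The automaton is a constant, so it is harmless that
its construction uses choice. -/
theorem computable_game : Computable (game X Y Z P i₀) := by
  have h : Primrec fun m => (Instance.equiv n).symm (Ins.automaton (expand Z (program X Y Z P i₀)),
      Ins.achilles (expand Z (program X Y Z P i₀)), 0,
      code ((((none, 0), 0) : (Option I × Fin 14) × Fin 6)), fractions X Y m,
      Ins.final (expand Z (program X Y Z P i₀)), 8) :=
    (Primrec.of_equiv_symm (e := Instance.equiv n)).comp <| (Primrec.const _).pair <|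
      (Primrec.const _).pair <| (Primrec.const _).pair <| (Primrec.const _).pair <|
        primrec_fractions.pair <| Primrec.const _
  exact h.to_comp

end RelGame

end RHA

open Nat.Partrec (Code) in
/-- No algorithm decides whether a number is in the domain of this partial recursive function. -/
theorem exists_partrec_undecidable_dom : ∃ f : ℕ →. ℕ, Nat.Partrec f ∧
    ¬ ∃ d : ℕ → Bool, Computable d ∧ ∀ m, d m = true ↔ (f (m + 1)).Dom := by
  -- The predecessor matches the shifted inputs `m + 1`, which come from the denominators of `Y`.
  refine ⟨fun k => (Denumerable.ofNat Code k.pred).eval 0, Partrec.nat_iff.1 ?_, ?_⟩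
  · exact Code.eval_part.comp ((Primrec.ofNat Code).comp Primrec.pred).to_comp (Computable.const 0)
  · rintro ⟨d, hd, h⟩
    refine ComputablePred.halting_problem 0 (ComputablePred.computable_iff.2
      ⟨_, hd.comp Computable.encode, funext fun c => ?_⟩)
    rw [h]
    simp

/-- For every `n ≥ 3`, no algorithm decides, given a time-bounded reachability game on a recursive
stopwatch automaton with `n` stopwatches, whether Achilles wins. -/
theorem mainTheorem3 (n : ℕ) (hn : 3 ≤ n) :
    ¬ ∃ decide : RHA.Instance n → Bool, Computable decide ∧
      ∀ I : RHA.Instance n, I.IsRSAGame → (decide I = true ↔ I.AchillesWins) := by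
  rintro ⟨d, hd, h⟩
  obtain ⟨f, hf, hdom⟩ := exists_partrec_undecidable_dom
  -- Nothing has to be extended, so the base is the empty system.
  obtain ⟨J, _, Q, -, -, j, hj⟩ := RelEq.definable_graph hf Empty Empty.elim
  let X : Fin n := ⟨0, by omega⟩
  let Y : Fin n := ⟨1, by omega⟩
  let Z : Fin n := ⟨2, by omega⟩
  refine hdom ⟨_, hd.comp (RHA.RelGame.computable_game (X := X) (Y := Y) (Z := Z) (P := Q)
    (i₀ := j)), fun m => ?_⟩
  rw [h _ RHA.RelGame.isRSAGame_game, RHA.RelGame.achillesWins_game (by simp [X, Y])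
    (by simp [X, Z]) (by simp [Y, Z]) hj, Part.dom_iff_mem]
  rfl
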